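/- Let $n\ge 3$ be an integer, and let $\theta_3\in\mathbb R$ and $c>0$. There is $\epsilon>0$, depending only on $n,\theta_3,c$, such that for all $\sigma\ge 0$, $\theta_2\in\mathbb R$ and $v>0$ there is a constant $C_*>0$, depending only on $n,\theta_2,\theta_3,c,v,\sigma$, with the following property. Let $(M,g)$ be a compact connected smooth Riemannian manifold without boundary, of dimension $n$, with $\mathrm{Vol}(M)\ge v$, for which the Sobolev inequality $$\|u\|_{\frac{2n}{n-2}}\le \frac1{C_s}\|du\|_2+\mathrm{Vol}(M)^{-\sigma}\|u\|_2\qquad\text{for every Lipschitz function } u \text{ on } M$$ holds with a constant $C_s\ge c$. Let $\theta_1\le\frac14$ and let $f\ge 0$ be a Lipschitz function on $M$ satisfying $$f\,\Delta f\ \ge\ -\theta_1|\nabla f|^2-\theta_2f^2-\theta_3f^3$$ in the weak sense, that is, $$-\int_M\langle\nabla f,\nabla(\varphi f)\rangle\,dv_g\ \ge\ \int_M\varphi\,\bigl(-\theta_1|\nabla f|^2-\theta_2f^2-\theta_3f^3\bigr)\,dv_g$$ for every Lipschitz function $\varphi\ge 0$ on $M$. Then for every $P\in M$ and every $r>0$: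 if $$\int_{B_P(2r)}f^{\frac n2}\,dv_g\le\epsilon,$$ then $$\sup_{B_P(\frac r2)}f\ \le\ C_*\Bigl(1+\frac1{r^2}\Bigr)\Bigl(\int_{B_P(r)}f^{\frac n2}\,dv_g\Bigr)^{\frac2n}.$$ -/

import Mathlib

open MeasureTheory Set
open scoped Manifold ContDiff Bundle ENNReal NNReal

noncomputable section

namespace MoserLemma

section Riemannian

variable (n : ℕ) {M : Type*} [TopologicalSpace M] [ChartedSpace (EuclideanSpace ℝ (Fin n)) M]
  [Bundle.RiemannianBundle (fun x : M => TangentSpace (𝓡 n) x)]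

/-- The coordinate vector field `∂ᵢ` of the preferred chart around `x`, at the point of `M` with
coordinates `y`: the image of the `i`-th standard basis vector under the derivative at `y` of the
inverse of the chart. -/
def coordVector (x : M) (y : EuclideanSpace ℝ (Fin n)) (i : Fin n) :
    TangentSpace (𝓡 n) ((chartAt (EuclideanSpace ℝ (Fin n)) x).symm y) :=
  mfderiv (𝓡 n) (𝓡 n) (chartAt (EuclideanSpace ℝ (Fin n)) x).symm y
    (EuclideanSpace.single i (1 : ℝ) : EuclideanSpace ℝ (Fin n))

/-- The matrix `g_ij = g(∂ᵢ, ∂ⱼ)` of the metric in the preferred chart around `x`, at the point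
with coordinates `y`. -/
def metricMatrix (x : M) (y : EuclideanSpace ℝ (Fin n)) : Matrix (Fin n) (Fin n) ℝ :=
  Matrix.of fun i j => inner ℝ (coordVector n x y i) (coordVector n x y j)

/-- The Riemannian measure `√(det g_ij) dy` on the domain of the preferred chart around `x`,
extended by zero to `M`. -/
def chartVolume [MeasurableSpace M] (x : M) : Measure M :=
  (((volume : Measure (EuclideanSpace ℝ (Fin n))).restrict
      (chartAt (EuclideanSpace ℝ (Fin n)) x).target).withDensity
    (fun y => ENNReal.ofReal (Real.sqrt (metricMatrix n x y).det))).map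
      (chartAt (EuclideanSpace ℝ (Fin n)) x).symm

/-- The Riemannian volume measure `dv_g` of `M`. By the change of variables formula the measures
`√(det g_ij) dy` of any two charts agree on the overlap of their domains, so the measure on `M`
that restricts to each of them is their supremum, the least measure that dominates all of them. -/
def riemVolume (M : Type*) [TopologicalSpace M] [ChartedSpace (EuclideanSpace ℝ (Fin n)) M]
    [Bundle.RiemannianBundle (fun x : M => TangentSpace (𝓡 n) x)] [MeasurableSpace M] :
    Measure M :=
  ⨆ x : M, chartVolume n x

/-- The total volume `Vol(M)`. -/
def totalVolume (M : Type*) [TopologicalSpace M] [ChartedSpace (EuclideanSpace ℝ (Fin n)) M]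
    [Bundle.RiemannianBundle (fun x : M => TangentSpace (𝓡 n) x)] [MeasurableSpace M] : ℝ :=
  (riemVolume n M).real univ

instance tangentSpaceCompleteSpace (x : M) : CompleteSpace (TangentSpace (𝓡 n) x) :=
  haveI : FiniteDimensional ℝ (TangentSpace (𝓡 n) x) :=
    inferInstanceAs (FiniteDimensional ℝ (EuclideanSpace ℝ (Fin n)))
  FiniteDimensional.complete ℝ _

/-- The Riemannian gradient of `u` at `x`: the vector that represents the differential `du_x` in
the inner product `g_x`. A Lipschitz function is differentiable at almost every point, and at the
remaining points the value is `0`. -/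
def grad (u : M → ℝ) (x : M) : TangentSpace (𝓡 n) x :=
  (InnerProductSpace.toDual ℝ (TangentSpace (𝓡 n) x)).symm
    (mfderiv (𝓡 n) 𝓘(ℝ, ℝ) u x : TangentSpace (𝓡 n) x →L[ℝ] ℝ)

end Riemannian

section Metric

variable (n : ℕ) (M : Type*) [MetricSpace M] [ChartedSpace (EuclideanSpace ℝ (Fin n)) M]
  [Bundle.RiemannianBundle (fun x : M => TangentSpace (𝓡 n) x)] [MeasurableSpace M]

/-- The Sobolev inequality
`‖u‖_{2n/(n-2)} ≤ (1/C_s) ‖du‖_2 + Vol(M)^{-σ} ‖u‖_2` for all Lipschitz functions `u` on `M`. -/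
def SobolevInequality (σ Cs : ℝ) : Prop :=
  ∀ u : M → ℝ, (∃ K : ℝ≥0, LipschitzWith K u) →
    (∫ x, |u x| ^ (2 * (n : ℝ) / ((n : ℝ) - 2)) ∂(riemVolume n M)) ^
        (((n : ℝ) - 2) / (2 * (n : ℝ))) ≤
      1 / Cs * (∫ x, ‖grad n u x‖ ^ 2 ∂(riemVolume n M)) ^ (1 / 2 : ℝ) +
        totalVolume n M ^ (-σ) * (∫ x, |u x| ^ 2 ∂(riemVolume n M)) ^ (1 / 2 : ℝ)

variable {M}

/-- The differential inequality `f Δf ≥ -θ₁ |∇f|² - θ₂ f² - θ₃ f³` in the weak sense, for a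
Lipschitz function `f`: multiply by a nonnegative Lipschitz function `φ`, integrate over `M`, and
integrate `∫ φ f Δf` by parts. -/
def WeakDiffIneq (θ₁ θ₂ θ₃ : ℝ) (f : M → ℝ) : Prop :=
  ∀ φ : M → ℝ, (∃ K : ℝ≥0, LipschitzWith K φ) → (∀ x, 0 ≤ φ x) →
    ∫ x, φ x * (-θ₁ * ‖grad n f x‖ ^ 2 - θ₂ * f x ^ 2 - θ₃ * f x ^ 3) ∂(riemVolume n M) ≤
      -∫ x, inner ℝ (grad n f x) (grad n (fun z => φ z * f z) x) ∂(riemVolume n M)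

end Metric

end MoserLemma

end

namespace MoserLemma

/-! The proof is a Moser iteration in which the cubic term is truncated at a level that grows with
the exponent. Testing the differential inequality with `η² (f + δ)^(p-2)`, where `η` is a cutoff,
gives a Caccioppoli estimate (`caccioppoli`). The Sobolev inequality for `η (f + δ)^(p/2)` then
bounds the `L^κ` norm of `η² (f + δ)^p`, with `κ = n/(n-2)`, by the integral of `(f + δ)^p` on the
larger ball, up to the cubic contribution `|θ₃| ∫ f η² (f + δ)^p`. Where `f ≤ l` that contribution
is of lower order. Where `f > l`, Hölder bounds it by `(∫_{f > l} f^(n/2))^(2/n)` times the Sobolev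
norm, which can be absorbed when this factor is at most a constant times `1/p²`. This is
`reverse_holder`. A fixed `ε` cannot meet that condition for all exponents `p_k = (n/2) κ^k`. It
does so for `p_0` with `l = 0`, and this is all that determines `ε`, so `ε` involves only `n`, `θ₃`,
`c`. The first step gives `∫ f^(nκ/2) ≤ H^κ` on a smaller ball, with `H` proportional to `1 + 1/r²`.
By Chebyshev the mass of `f^(n/2)` above level `l` is then at most `(H/l)^κ`, so a level growing
geometrically in `k` meets the condition at every later step (`moser_estimate`). The step constants
are thus at most `D b^k` with `D` proportional to `1 + 1/r²`. Since `∑ κ^(-k) = n/2`, taking the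
final `2/n`-th power leaves exactly one factor `D`, and letting `p_k → ∞` gives the supremum bound.
-/

lemma isContinuousRiemannianBundle_tangentSpace {n : ℕ} {M : Type*} [MetricSpace M]
  [ChartedSpace (EuclideanSpace ℝ (Fin n)) M] [IsManifold (𝓡 n) ∞ M]
  [Bundle.RiemannianBundle (fun x : M => TangentSpace (𝓡 n) x)]
  [h : IsContMDiffRiemannianBundle (𝓡 n) ∞ (EuclideanSpace ℝ (Fin n))
          (fun x : M => TangentSpace (𝓡 n) x)] :
    IsContinuousRiemannianBundle (EuclideanSpace ℝ (Fin n))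
          (fun x : M => TangentSpace (𝓡 n) x) := by
  obtain ⟨g, hg, h⟩ := h.exists_contMDiff
  exact ⟨g, hg.continuous, h⟩

/-! ### Charts: continuity and nondegeneracy of the metric in coordinates -/

section Chart

variable {n : ℕ} {M : Type*} [MetricSpace M]
  [ChartedSpace (EuclideanSpace ℝ (Fin n)) M] [IsManifold (𝓡 n) ∞ M]

local notation "𝔼" => EuclideanSpace ℝ (Fin n)

lemma continuousOn_mfderiv_chart_symm (x : M) (e : 𝔼) :
    ContinuousOn (fun y : 𝔼 =>
      (⟨(chartAt 𝔼 x).symm y, mfderiv (𝓡 n) (𝓡 n) (chartAt 𝔼 x).symm y e⟩ : TangentBundle (𝓡 n) M))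
      (chartAt 𝔼 x).target := by
  have h := (contMDiffOn_chart_symm (I := 𝓡 n) (n := ∞) (x := x)).continuousOn_tangentMapWithin
    (by simp) (chartAt 𝔼 x).open_target.uniqueMDiffOn
  have h2 : ContinuousOn (fun y : 𝔼 => (⟨y, e⟩ : TangentBundle (𝓡 n) 𝔼)) (chartAt 𝔼 x).target := by
    apply Continuous.continuousOn
    have := (tangentBundleModelSpaceHomeomorph (𝓡 n)).symm.continuous.comp
      (Continuous.prodMk continuous_id (continuous_const (y := e)))
    convert! this
  refine (h.comp h2 (fun y hy => hy)).congr fun y hy => ?_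
  simp only [Function.comp, tangentMapWithin]
  rw [mfderivWithin_of_isOpen (chartAt 𝔼 x).open_target hy]

lemma bijective_mfderiv_chart_symm (x : M) {y : 𝔼} (hy : y ∈ (chartAt 𝔼 x).target) :
    Function.Bijective (mfderiv (𝓡 n) (𝓡 n) (chartAt 𝔼 x).symm y) :=
  (mdifferentiable_chart (I := 𝓡 n) x).symm.mfderiv_bijective hy

variable [Bundle.RiemannianBundle (fun x : M => TangentSpace (𝓡 n) x)]
  [IsContinuousRiemannianBundle (EuclideanSpace ℝ (Fin n))
          (fun x : M => TangentSpace (𝓡 n) x)]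

lemma continuousOn_inner_mfderiv_chart_symm (x : M) (e e' : 𝔼) :
    ContinuousOn (fun y : 𝔼 =>
      inner ℝ (mfderiv (𝓡 n) (𝓡 n) (chartAt 𝔼 x).symm y e :
          TangentSpace (𝓡 n) ((chartAt 𝔼 x).symm y))
         (mfderiv (𝓡 n) (𝓡 n) (chartAt 𝔼 x).symm y e' : TangentSpace (𝓡 n) ((chartAt 𝔼 x).symm y)))
      (chartAt 𝔼 x).target :=
  ContinuousOn.inner_bundle (F := 𝔼) (E := fun x : M => TangentSpace (𝓡 n) x)
    (continuousOn_mfderiv_chart_symm x e) (continuousOn_mfderiv_chart_symm x e')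

lemma continuousOn_norm_mfderiv_chart_symm (x : M) (e : 𝔼) :
    ContinuousOn (fun y : 𝔼 =>
      ‖(mfderiv (𝓡 n) (𝓡 n) (chartAt 𝔼 x).symm y e : TangentSpace (𝓡 n) ((chartAt 𝔼 x).symm y))‖)
      (chartAt 𝔼 x).target := by
  simp only [norm_eq_sqrt_real_inner]
  exact (continuousOn_inner_mfderiv_chart_symm x e e).sqrt

lemma continuousOn_metricMatrix_det (x : M) :
    ContinuousOn (fun y : 𝔼 => (metricMatrix n x y).det) (chartAt 𝔼 x).target := by
  have : ContinuousOn (fun y : 𝔼 => metricMatrix n x y) (chartAt 𝔼 x).target := by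
    refine continuousOn_pi.2 fun i => continuousOn_pi.2 fun j => ?_
    exact continuousOn_inner_mfderiv_chart_symm x _ _
  exact (Continuous.matrix_det continuous_id).comp_continuousOn this

omit [IsContinuousRiemannianBundle (EuclideanSpace ℝ (Fin n))
    (fun x : M => TangentSpace (𝓡 n) x)] in
lemma metricMatrix_det_pos (x : M) {y : 𝔼} (hy : y ∈ (chartAt 𝔼 x).target) :
    0 < (metricMatrix n x y).det := by
  have hli : LinearIndependent ℝ (fun i => coordVector n x y i) := by
    have h1 : LinearIndependent ℝ (fun i : Fin n => (EuclideanSpace.single i (1 : ℝ) : 𝔼)) := by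
      convert! (EuclideanSpace.basisFun (Fin n) ℝ).orthonormal.linearIndependent with i
      simp
    exact h1.map' (mfderiv (𝓡 n) (𝓡 n) (chartAt 𝔼 x).symm y).toLinearMap
      (LinearMap.ker_eq_bot.2 (bijective_mfderiv_chart_symm x hy).1)
  exact (Matrix.posDef_gram_of_linearIndependent hli).det_pos
end Chart

/-! ### Riemannian distance and gradient in a chart -/

section ChartMetric

variable {n : ℕ} {M : Type*} [MetricSpace M]
  [ChartedSpace (EuclideanSpace ℝ (Fin n)) M] [IsManifold (𝓡 n) ∞ M]
  [Bundle.RiemannianBundle (fun x : M => TangentSpace (𝓡 n) x)]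

local notation "𝔼" => EuclideanSpace ℝ (Fin n)

/-- The image of the straight segment is a competitor for the Riemannian distance. Its parameter
interval has length one, so a bound on its speed bounds its length. -/
lemma dist_chart_symm_le [IsRiemannianManifold (𝓡 n) M] (x : M) {y z : 𝔼} {L : ℝ≥0}
    (hs : segment ℝ y z ⊆ (chartAt 𝔼 x).target)
    (hL : ∀ w ∈ segment ℝ y z,
      ‖(mfderiv (𝓡 n) (𝓡 n) (chartAt 𝔼 x).symm w (z - y) :
        TangentSpace (𝓡 n) ((chartAt 𝔼 x).symm w))‖ ≤ L) :
    dist ((chartAt 𝔼 x).symm y) ((chartAt 𝔼 x).symm z) ≤ L := by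
  set φ := (chartAt 𝔼 x).symm with hφ
  let η : ℝ → 𝔼 := ContinuousAffineMap.lineMap (R := ℝ) y z
  have hη : ContMDiffOn 𝓘(ℝ, ℝ) (𝓡 n) 1 η (Icc 0 1) := by
    apply ContMDiff.contMDiffOn
    rw [contMDiff_iff_contDiff]
    exact ContinuousAffineMap.contDiff _
  have hmem : ∀ t ∈ Icc (0 : ℝ) 1, η t ∈ segment ℝ y z := by
    intro t ht
    rw [segment_eq_image_lineMap]
    exact ⟨t, ht, rfl⟩
  have h1 : Manifold.riemannianEDist (𝓡 n) (φ y) (φ z) ≤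
      Manifold.pathELength (𝓡 n) (φ ∘ η) 0 1 := by
    apply Manifold.riemannianEDist_le_pathELength _ _ _ zero_le_one
    · exact (contMDiffOn_chart_symm (x := x)).comp hη fun t ht => hs (hmem t ht)
    · simp [η, ContinuousAffineMap.coe_lineMap_eq]
    · simp [η, ContinuousAffineMap.coe_lineMap_eq]
  rw [← coe_nndist, NNReal.coe_le_coe, ← edist_le_coe, IsRiemannianManifold.out (I := 𝓡 n)]
  refine h1.trans ?_
  rw [Manifold.pathELength_eq_lintegral_mfderivWithin_Icc]
  have : (L : ℝ≥0∞) = ∫⁻ t in Icc (0 : ℝ) 1, L := by simp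
  rw [this]
  apply setLIntegral_mono' measurableSet_Icc (fun t ht => ?_)
  have hd : mfderivWithin 𝓘(ℝ, ℝ) (𝓡 n) (φ ∘ η) (Icc 0 1) t =
      (mfderiv (𝓡 n) (𝓡 n) φ (η t)) ∘L (mfderivWithin 𝓘(ℝ, ℝ) (𝓡 n) η (Icc 0 1) t) := by
    apply mfderiv_comp_mfderivWithin
    · exact (mdifferentiable_chart (I := 𝓡 n) x).mdifferentiableAt_symm (hs (hmem t ht))
    · exact hη.mdifferentiableOn one_ne_zero t ht
    · rw [uniqueMDiffWithinAt_iff_uniqueDiffWithinAt]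
      exact uniqueDiffOn_Icc zero_lt_one t ht
  have hη' : (mfderivWithin 𝓘(ℝ, ℝ) (𝓡 n) η (Icc 0 1) t) 1 = z - y := by
    rw [mfderivWithin_eq_fderivWithin, fderivWithin_eq_fderiv (uniqueDiffOn_Icc zero_lt_one _ ht)
      (ContinuousAffineMap.differentiableAt _)]
    exact fderiv_apply_one_eq_deriv.trans AffineMap.hasDerivAt_lineMap.deriv
  rw [hd]
  have := hL _ (hmem t ht)
  rw [ContinuousLinearMap.comp_apply, hη']
  rw [enorm_le_coe]
  exact this

variable [IsContinuousRiemannianBundle (EuclideanSpace ℝ (Fin n))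
          (fun x : M => TangentSpace (𝓡 n) x)]

/-- The differential of the inverse of a chart is locally bounded. -/
lemma exists_norm_mfderiv_chart_symm_le (x : M) {y : 𝔼} (hy : y ∈ (chartAt 𝔼 x).target) :
    ∃ C : ℝ≥0, ∀ᶠ w in nhds y, ∀ e : 𝔼,
      ‖(mfderiv (𝓡 n) (𝓡 n) (chartAt 𝔼 x).symm w e : TangentSpace (𝓡 n) ((chartAt 𝔼 x).symm w))‖
        ≤ C * ‖e‖ := by
  have key : ContinuousAt (fun w : 𝔼 => ∑ i, ‖coordVector n x w i‖) y := by
    apply ContinuousOn.continuousAt _ ((chartAt 𝔼 x).open_target.mem_nhds hy)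
    apply continuousOn_finsetSum
    intro i _
    exact continuousOn_norm_mfderiv_chart_symm x _
  set S := ∑ i, ‖coordVector n x y i‖
  have hS : 0 ≤ S := Finset.sum_nonneg fun i _ => norm_nonneg _
  refine ⟨⟨S + 1, by positivity⟩, ?_⟩
  filter_upwards [key.eventually (gt_mem_nhds (lt_add_one S))] with w hw e
  have he : e = ∑ i, e i • (EuclideanSpace.single i (1 : ℝ) : 𝔼) := by
    have := (EuclideanSpace.basisFun (Fin n) ℝ).sum_repr e
    simpa using this.symm
  have h2 : (mfderiv (𝓡 n) (𝓡 n) (chartAt 𝔼 x).symm w e : TangentSpace (𝓡 n) ((chartAt 𝔼 x).symm w))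
      = ∑ i, e i • coordVector n x w i := by
    conv_lhs => rw [he]
    exact (map_sum _ _ _).trans (Finset.sum_congr rfl fun i _ => map_smul _ _ _)
  rw [h2]
  calc _ ≤ ∑ i, ‖e i • coordVector n x w i‖ := norm_sum_le _ _
    _ = ∑ i, ‖e i‖ * ‖coordVector n x w i‖ := by simp only [norm_smul]
    _ ≤ ∑ i, ‖e‖ * ‖coordVector n x w i‖ := by
      gcongr with i
      exact PiLp.norm_apply_le e i
    _ = (∑ i, ‖coordVector n x w i‖) * ‖e‖ := by rw [← Finset.mul_sum, mul_comm]
    _ ≤ (S + 1) * ‖e‖ := by gcongr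

lemma exists_lipschitzOnWith_chart_symm [IsRiemannianManifold (𝓡 n) M] (x : M) {y : 𝔼}
    (hy : y ∈ (chartAt 𝔼 x).target) :
    ∃ C : ℝ≥0, ∃ s ∈ nhds y, LipschitzOnWith C (chartAt 𝔼 x).symm s := by
  obtain ⟨C, hC⟩ := exists_norm_mfderiv_chart_symm_le x hy
  obtain ⟨r, hr, hball⟩ := Metric.eventually_nhds_iff_ball.1
    (hC.and ((chartAt 𝔼 x).open_target.mem_nhds hy))
  refine ⟨C, Metric.ball y r, Metric.ball_mem_nhds _ hr, LipschitzOnWith.of_dist_le_mul ?_⟩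
  intro z hz w hw
  have hseg := (convex_ball y r).segment_subset hz hw
  have := dist_chart_symm_le x (L := C * ‖w - z‖₊) (fun u hu => (hball u (hseg hu)).2)
    (fun u hu => (hball u (hseg hu)).1 _)
  simpa [dist_eq_norm, norm_sub_rev] using this

omit [IsContinuousRiemannianBundle (EuclideanSpace ℝ (Fin n))
          (fun x : M => TangentSpace (𝓡 n) x)] in
omit [IsManifold (𝓡 n) ∞ M] in
lemma inner_grad_eq_mfderiv (u : M → ℝ) (x : M) (v : TangentSpace (𝓡 n) x) :
    inner ℝ (grad n u x) v = mfderiv (𝓡 n) 𝓘(ℝ, ℝ) u x v :=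
  InnerProductSpace.toDual_symm_apply (𝕜 := ℝ) (E := TangentSpace (𝓡 n) x) (x := v)
    (y := (mfderiv (𝓡 n) 𝓘(ℝ, ℝ) u x : TangentSpace (𝓡 n) x →L[ℝ] ℝ))

omit [IsManifold (𝓡 n) ∞ M] [IsContinuousRiemannianBundle (EuclideanSpace ℝ (Fin n))
          (fun x : M => TangentSpace (𝓡 n) x)] in
lemma grad_eq_iff {u : M → ℝ} {x : M} {v : TangentSpace (𝓡 n) x} :
    grad n u x = v ↔ ∀ w, mfderiv (𝓡 n) 𝓘(ℝ, ℝ) u x w = inner ℝ v w := by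
  constructor
  · rintro rfl w
    rw [inner_grad_eq_mfderiv]
  · intro h
    refine ext_inner_right ℝ fun w => ?_
    rw [inner_grad_eq_mfderiv]
    exact h w

omit [IsManifold (𝓡 n) ∞ M] [IsContinuousRiemannianBundle (EuclideanSpace ℝ (Fin n))
          (fun x : M => TangentSpace (𝓡 n) x)] in
lemma grad_of_not_mdifferentiableAt {u : M → ℝ} {x : M}
    (hd : ¬ MDifferentiableAt (𝓡 n) 𝓘(ℝ, ℝ) u x) : grad n u x = 0 := by
  rw [grad_eq_iff, mfderiv_zero_of_not_mdifferentiableAt hd]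
  intro w
  rw [inner_zero_left]
  rfl

omit [IsContinuousRiemannianBundle (EuclideanSpace ℝ (Fin n))
          (fun x : M => TangentSpace (𝓡 n) x)] in
lemma hasFDerivAt_comp_chart_symm {u : M → ℝ} (x : M) {y : 𝔼} (hy : y ∈ (chartAt 𝔼 x).target)
    (hd : MDifferentiableAt (𝓡 n) 𝓘(ℝ, ℝ) u ((chartAt 𝔼 x).symm y)) :
    DifferentiableAt ℝ (u ∘ (chartAt 𝔼 x).symm) y ∧ ∀ e, fderiv ℝ (u ∘ (chartAt 𝔼 x).symm) y e =
      inner ℝ (grad n u ((chartAt 𝔼 x).symm y)) (mfderiv (𝓡 n) (𝓡 n) (chartAt 𝔼 x).symm y e :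
        TangentSpace (𝓡 n) ((chartAt 𝔼 x).symm y)) := by
  have hφ : MDifferentiableAt (𝓡 n) (𝓡 n) (chartAt 𝔼 x).symm y :=
    (mdifferentiable_chart (I := 𝓡 n) x).mdifferentiableAt_symm hy
  refine ⟨(hd.comp y hφ).differentiableAt, fun e => ?_⟩
  rw [inner_grad_eq_mfderiv, ← mfderiv_eq_fderiv, mfderiv_comp y hd hφ]
  rfl

omit [IsContinuousRiemannianBundle (EuclideanSpace ℝ (Fin n))
          (fun x : M => TangentSpace (𝓡 n) x)]
  [Bundle.RiemannianBundle (fun x : M => TangentSpace (𝓡 n) x)] in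
lemma mdifferentiableAt_chart_symm_iff {u : M → ℝ} (x : M) {y : 𝔼} (hy : y ∈ (chartAt 𝔼 x).target) :
    MDifferentiableAt (𝓡 n) 𝓘(ℝ, ℝ) u ((chartAt 𝔼 x).symm y) ↔
      DifferentiableAt ℝ (u ∘ (chartAt 𝔼 x).symm) y := by
  constructor
  · intro hd
    exact (hd.comp y
      ((mdifferentiable_chart (I := 𝓡 n) x).mdifferentiableAt_symm hy)).differentiableAt
  · intro hd
    have hs := (chartAt 𝔼 x).map_target hy
    have h1 : MDifferentiableAt (𝓡 n) (𝓡 n) (chartAt 𝔼 x) ((chartAt 𝔼 x).symm y) :=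
      (mdifferentiable_chart (I := 𝓡 n) x).mdifferentiableAt hs
    have h2 : MDifferentiableAt (𝓡 n) 𝓘(ℝ, ℝ) (u ∘ (chartAt 𝔼 x).symm)
        (chartAt 𝔼 x ((chartAt 𝔼 x).symm y)) := by
      rw [(chartAt 𝔼 x).right_inv hy]
      exact hd.mdifferentiableAt
    refine (h2.comp _ h1).congr_of_eventuallyEq ?_
    filter_upwards [(chartAt 𝔼 x).open_source.mem_nhds hs] with z hz
    simp [(chartAt 𝔼 x).left_inv hz]

/-- The gradient of a `K`-Lipschitz function has norm at most `K`. -/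
lemma norm_grad_le [IsRiemannianManifold (𝓡 n) M] {u : M → ℝ} {K : ℝ≥0} (hu : LipschitzWith K u)
    (x : M) : ‖grad n u x‖ ≤ K := by
  by_cases hd : MDifferentiableAt (𝓡 n) 𝓘(ℝ, ℝ) u x
  swap
  · rw [grad_of_not_mdifferentiableAt hd]
    simp
  have hyt : chartAt 𝔼 x x ∈ (chartAt 𝔼 x).target := mem_chart_target _ x
  have hφy := (chartAt 𝔼 x).left_inv (mem_chart_source 𝔼 x)
  rw [← hφy] at hd ⊢
  generalize chartAt 𝔼 x x = y at hyt hd ⊢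
  obtain ⟨hd', hD⟩ := hasFDerivAt_comp_chart_symm x hyt hd
  -- The direction whose image is the gradient itself: along it `u` has derivative `‖g‖²`, while by
  -- continuity of the metric the nearby points move at speed less than `‖g‖ + δ`.
  obtain ⟨e, he⟩ : ∃ e : 𝔼, (mfderiv (𝓡 n) (𝓡 n) (chartAt 𝔼 x).symm y e :
      TangentSpace (𝓡 n) ((chartAt 𝔼 x).symm y)) = grad n u ((chartAt 𝔼 x).symm y) :=
    (bijective_mfderiv_chart_symm x hyt).2 _
  set g := grad n u ((chartAt 𝔼 x).symm y)
  have hcont : ContinuousAt (fun w : 𝔼 => ‖(mfderiv (𝓡 n) (𝓡 n) (chartAt 𝔼 x).symm w e :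
      TangentSpace (𝓡 n) ((chartAt 𝔼 x).symm w))‖) y :=
    (continuousOn_norm_mfderiv_chart_symm x e).continuousAt ((chartAt 𝔼 x).open_target.mem_nhds hyt)
  have key : ∀ δ : ℝ, 0 < δ → ‖g‖ ^ 2 ≤ K * (‖g‖ + δ) := by
    intro δ hδ
    have hev : ∀ᶠ w in nhds y, ‖(mfderiv (𝓡 n) (𝓡 n) (chartAt 𝔼 x).symm w e :
      TangentSpace (𝓡 n) ((chartAt 𝔼 x).symm w))‖ < ‖g‖ + δ := by
      apply hcont.eventually (gt_mem_nhds _)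
      beta_reduce
      rw [he]
      exact lt_add_of_pos_right _ hδ
    obtain ⟨r, hr, hball⟩ := Metric.eventually_nhds_iff_ball.1
      (hev.and ((chartAt 𝔼 x).open_target.mem_nhds hyt))
    have hline : HasDerivAt (fun t : ℝ => (u ∘ (chartAt 𝔼 x).symm) (y + t • e)) (‖g‖ ^ 2) 0 := by
      have h1 : HasDerivAt (fun t : ℝ => y + t • e) e 0 := by
        simpa using ((hasDerivAt_id (0 : ℝ)).smul_const e).const_add y
      have h2 : HasFDerivAt (u ∘ (chartAt 𝔼 x).symm) (fderiv ℝ (u ∘ (chartAt 𝔼 x).symm) y)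
        (y + (0 : ℝ) • e) := by simpa using hd'.hasFDerivAt
      have h3 := h2.comp_hasDerivAt (0 : ℝ) h1
      rw [hD e, he, real_inner_self_eq_norm_sq] at h3
      exact h3
    have hmem : ∀ᶠ t : ℝ in nhds 0, y + t • e ∈ Metric.ball y r := by
      have : ContinuousAt (fun t : ℝ => y + t • e) 0 := by fun_prop
      apply this.eventually
      simpa using Metric.isOpen_ball.eventually_mem (Metric.mem_ball_self hr)
    refine le_trans (le_abs_self _) ?_
    rw [← Real.norm_eq_abs]
    refine hline.le_of_lip' (by positivity) ?_
    filter_upwards [hmem] with t ht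
    have hseg := (convex_ball y r).segment_subset (Metric.mem_ball_self hr) ht
    have hdist := dist_chart_symm_le x (L := ‖t‖₊ * ⟨‖g‖ + δ, by positivity⟩)
      (fun u hu => (hball u (hseg hu)).2) (fun u hu => by
        rw [add_sub_cancel_left]
        have := (hball u (hseg hu)).1.le
        have h4 : (mfderiv (𝓡 n) (𝓡 n) (chartAt 𝔼 x).symm u (t • e) :
          TangentSpace (𝓡 n) ((chartAt 𝔼 x).symm u)) =
            t • (mfderiv (𝓡 n) (𝓡 n) (chartAt 𝔼 x).symm u e :
          TangentSpace (𝓡 n) ((chartAt 𝔼 x).symm u)) := map_smul _ _ _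
        rw [h4, norm_smul]
        exact mul_le_mul_of_nonneg_left this (norm_nonneg t))
    have := hu.dist_le_mul ((chartAt 𝔼 x).symm (y + t • e)) ((chartAt 𝔼 x).symm y)
    rw [dist_comm] at hdist
    simp only [Function.comp, zero_smul, add_zero, sub_zero]
    rw [Real.dist_eq, ← Real.norm_eq_abs] at this
    refine this.trans ?_
    calc _ ≤ (K : ℝ) * (‖t‖ * (‖g‖ + δ)) := by
          gcongr
          exact hdist
      _ = _ := by ring
  have h2 : ‖g‖ ^ 2 ≤ K * ‖g‖ := by
    have : Filter.Tendsto (fun δ : ℝ => (K : ℝ) * (‖g‖ + δ)) (nhdsWithin 0 (Ioi 0))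
        (nhds (K * (‖g‖ + 0))) := by
      apply Filter.Tendsto.mono_left _ nhdsWithin_le_nhds
      exact Continuous.tendsto (by fun_prop) 0
    rw [add_zero] at this
    exact ge_of_tendsto this (eventually_nhdsWithin_of_forall fun δ hδ => key δ hδ)
  rcases (norm_nonneg g).eq_or_lt with h0 | h0
  · rw [← h0]; exact K.2
  · rw [pow_two] at h2
    exact le_of_mul_le_mul_right h2 h0
end ChartMetric

/-! ### Measurability of the gradient -/

section Measurable

variable {n : ℕ} {M : Type*} [MetricSpace M] [CompactSpace M]
  [ChartedSpace (EuclideanSpace ℝ (Fin n)) M] [MeasurableSpace M] [BorelSpace M]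

local notation "𝔼" => EuclideanSpace ℝ (Fin n)

/-- By compactness finitely many chart domains cover `M`, and each inverse chart, being continuous
and injective, maps Borel sets to Borel sets. -/
lemma measurableSet_of_chart {s : Set M}
    (h : ∀ x : M, MeasurableSet ((chartAt 𝔼 x).target ∩ (chartAt 𝔼 x).symm ⁻¹' s)) :
    MeasurableSet s := by
  obtain ⟨t, ht⟩ := CompactSpace.elim_nhds_subcover (fun x : M => (chartAt 𝔼 x).source)
    (fun x => chart_source_mem_nhds 𝔼 x)
  have hs : s = ⋃ x ∈ t,
      (chartAt 𝔼 x).symm '' ((chartAt 𝔼 x).target ∩ (chartAt 𝔼 x).symm ⁻¹' s) := by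
    ext z
    simp only [mem_iUnion]
    constructor
    · intro hz
      have : z ∈ ⋃ x ∈ t, (chartAt 𝔼 x).source := by rw [ht]; trivial
      simp only [mem_iUnion] at this
      obtain ⟨x, hx, hzx⟩ := this
      have h1 := (chartAt 𝔼 x).left_inv hzx
      exact ⟨x, hx, chartAt 𝔼 x z, ⟨(chartAt 𝔼 x).map_source hzx, by simpa [h1] using hz⟩, h1⟩
    · rintro ⟨x, hx, y, hy, rfl⟩
      exact hy.2
  rw [hs]
  refine t.measurableSet_biUnion fun x _ => ?_
  refine (h x).image_of_continuousOn_injOn ?_ ?_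
  · exact (chartAt 𝔼 x).continuousOn_symm.mono inter_subset_left
  · exact (chartAt 𝔼 x).symm.injOn.mono inter_subset_left

variable [IsManifold (𝓡 n) ∞ M]

lemma measurableSet_mdifferentiableAt (u : M → ℝ) :
    MeasurableSet {x | MDifferentiableAt (𝓡 n) 𝓘(ℝ, ℝ) u x} := by
  refine measurableSet_of_chart (n := n) fun x => ?_
  have : (chartAt 𝔼 x).target ∩ (chartAt 𝔼 x).symm ⁻¹' {x | MDifferentiableAt (𝓡 n) 𝓘(ℝ, ℝ) u x} =
      (chartAt 𝔼 x).target ∩ {y | DifferentiableAt ℝ (u ∘ (chartAt 𝔼 x).symm) y} := by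
    ext y
    simp only [mem_inter_iff, mem_preimage, mem_ofPred_eq]
    exact and_congr_right fun hy => mdifferentiableAt_chart_symm_iff x hy
  rw [this]
  exact (chartAt 𝔼 x).open_target.measurableSet.inter (measurableSet_of_differentiableAt ℝ _)

variable [Bundle.RiemannianBundle (fun x : M => TangentSpace (𝓡 n) x)]
  [IsContinuousRiemannianBundle (EuclideanSpace ℝ (Fin n)) (fun x : M => TangentSpace (𝓡 n) x)]

/-- For `c ≥ 0` the gradient norm exceeds `c` exactly when some direction `e` satisfies `c ‖dφ e‖ <
|d(u ∘ φ) e|`. This condition is open in `e`, so a countable dense set of directions suffices. -/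
lemma measurable_norm_grad (u : M → ℝ) : Measurable (fun x => ‖grad n u x‖) := by
  refine measurable_of_Ioi fun c => ?_
  rcases lt_or_ge c 0 with hc | hc
  · convert MeasurableSet.univ
    refine eq_univ_of_forall fun x => ?_
    exact hc.trans_le (norm_nonneg _)
  refine measurableSet_of_chart (n := n) fun x => ?_
  set φ := (chartAt 𝔼 x).symm with hφ
  set D := (chartAt 𝔼 x).target with hD
  have hDm : MeasurableSet D := (chartAt 𝔼 x).open_target.measurableSet
  obtain ⟨S, hSc, hSd⟩ := TopologicalSpace.exists_countable_dense 𝔼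
  have key : D ∩ φ ⁻¹' ((fun x => ‖grad n u x‖) ⁻¹' Ioi c) =
      D ∩ {y | DifferentiableAt ℝ (u ∘ φ) y} ∩
        ⋃ e ∈ S, D ∩ {y | c * ‖(mfderiv (𝓡 n) (𝓡 n) φ y e : TangentSpace (𝓡 n) (φ y))‖
        < |fderiv ℝ (u ∘ φ) y e|} := by
    ext y
    simp only [mem_inter_iff, mem_preimage, mem_Ioi, mem_ofPred_eq, mem_iUnion]
    constructor
    · rintro ⟨hy, hcy⟩
      have hd : MDifferentiableAt (𝓡 n) 𝓘(ℝ, ℝ) u (φ y) := by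
        by_contra hd
        rw [grad_of_not_mdifferentiableAt hd, norm_zero] at hcy
        exact absurd hcy hc.not_gt
      obtain ⟨hd', hfd⟩ := hasFDerivAt_comp_chart_symm x hy hd
      refine ⟨⟨hy, hd'⟩, ?_⟩
      obtain ⟨e, he⟩ : ∃ e : 𝔼, (mfderiv (𝓡 n) (𝓡 n) φ y e : TangentSpace (𝓡 n) (φ y))
          = grad n u (φ y) := (bijective_mfderiv_chart_symm x hy).2 _
      let T : 𝔼 →L[ℝ] TangentSpace (𝓡 n) (φ y) := mfderiv (𝓡 n) (𝓡 n) φ y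
      have hopen : IsOpen {e : 𝔼 | c * ‖T e‖ < |fderiv ℝ (u ∘ φ) y e|} :=
        isOpen_lt (by fun_prop) (by fun_prop)
      have hne : {e : 𝔼 | c * ‖T e‖ < |fderiv ℝ (u ∘ φ) y e|}.Nonempty := by
        refine ⟨e, ?_⟩
        have h1 : fderiv ℝ (u ∘ φ) y e = ‖grad n u (φ y)‖ ^ 2 := by
          rw [hfd e, he, real_inner_self_eq_norm_sq]
        have h2 : T e = grad n u (φ y) := he
        have h0 : 0 < ‖grad n u (φ y)‖ := hc.trans_lt hcy
        rw [mem_ofPred_eq, h1, h2, abs_of_nonneg (by positivity)]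
        nlinarith
      obtain ⟨e', he', heS⟩ := hSd.inter_open_nonempty _ hopen hne
      exact ⟨e', heS, hy, he'⟩
    · rintro ⟨⟨hy, hd'⟩, e, -, -, he⟩
      have hd := (mdifferentiableAt_chart_symm_iff x hy).2 hd'
      refine ⟨hy, ?_⟩
      rw [(hasFDerivAt_comp_chart_symm x hy hd).2 e] at he
      have h1 := he.trans_le (abs_real_inner_le_norm _ _)
      exact lt_of_mul_lt_mul_right h1 (norm_nonneg _)
  rw [key]
  refine (hDm.inter (measurableSet_of_differentiableAt ℝ _)).inter
    (MeasurableSet.biUnion hSc fun e _ => ?_)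
  have hm1 : Measurable (D.domRestrict fun y : 𝔼 =>
      c * ‖(mfderiv (𝓡 n) (𝓡 n) φ y e : TangentSpace (𝓡 n) (φ y))‖) :=
    (continuousOn_iff_continuous_domRestrict.1
      ((continuousOn_norm_mfderiv_chart_symm x e).const_mul c)).measurable
  have hm2 : Measurable (D.domRestrict fun y : 𝔼 => |fderiv ℝ (u ∘ φ) y e|) := by
    have := (measurable_fderiv_apply_const ℝ (u ∘ φ) e)
    exact (continuous_abs.measurable.comp this).comp measurable_subtype_coe
  have := hDm.subtype_image (measurableSet_lt hm1 hm2)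
  convert this using 1
  ext y
  constructor
  · rintro ⟨hy, h⟩
    exact ⟨⟨y, hy⟩, h, rfl⟩
  · rintro ⟨⟨y, hy⟩, h, rfl⟩
    exact ⟨hy, h⟩

end Measurable

/-! ### Riemannian volume: null sets, open sets, Rademacher -/

section Volume

variable {n : ℕ} {M : Type*} [MetricSpace M]
  [ChartedSpace (EuclideanSpace ℝ (Fin n)) M] [MeasurableSpace M] [BorelSpace M]
  [Bundle.RiemannianBundle (fun x : M => TangentSpace (𝓡 n) x)]

local notation "𝔼" => EuclideanSpace ℝ (Fin n)

lemma aemeasurable_chart_symm (x : M) :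
    AEMeasurable (chartAt 𝔼 x).symm (((volume : Measure 𝔼).restrict
      (chartAt 𝔼 x).target).withDensity
        (fun y => ENNReal.ofReal (Real.sqrt (metricMatrix n x y).det))) :=
  ((chartAt 𝔼 x).continuousOn_symm.aemeasurable
    (chartAt 𝔼 x).open_target.measurableSet).mono_ac (withDensity_absolutelyContinuous _ _)

lemma chartVolume_eq_zero (x : M) {s : Set M} (hs : MeasurableSet s)
    (h : volume ((chartAt 𝔼 x).target ∩ (chartAt 𝔼 x).symm ⁻¹' s) = 0) :
    chartVolume n x s = 0 := by
  rw [chartVolume, Measure.map_apply_of_aemeasurable (aemeasurable_chart_symm x) hs]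
  apply withDensity_absolutelyContinuous
  rw [Measure.restrict_apply' (chartAt 𝔼 x).open_target.measurableSet, inter_comm]
  exact h

omit [BorelSpace M] in
-- A supremum of measures is not computed set by set. Instead, the restriction of the volume to `sᶜ`
-- still dominates every chart measure, hence dominates the least upper bound.
lemma riemVolume_eq_zero {s : Set M} (hs : MeasurableSet s) (h : ∀ x : M, chartVolume n x s = 0) :
    riemVolume n M s = 0 := by
  have hle : riemVolume n M ≤ (riemVolume n M).restrict sᶜ := by
    refine iSup_le fun x => Measure.le_iff.2 fun t ht => ?_
    rw [Measure.restrict_apply ht]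
    have h1 : chartVolume n x t ≤ chartVolume n x (t ∩ sᶜ) + chartVolume n x s :=
      (measure_mono (fun z hz => by by_cases hzs : z ∈ s <;> simp [hz, hzs])).trans
        (measure_union_le (t ∩ sᶜ) s)
    rw [h x, add_zero] at h1
    exact h1.trans (le_iSup (fun x : M => chartVolume n x) x _)
  have := hle s
  rw [Measure.restrict_apply hs] at this
  simpa using this

variable [IsManifold (𝓡 n) ∞ M]
  [IsContinuousRiemannianBundle (EuclideanSpace ℝ (Fin n)) (fun x : M => TangentSpace (𝓡 n) x)]

lemma riemVolume_pos_of_isOpen {U : Set M} (hU : IsOpen U) (hne : U.Nonempty) :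
    0 < riemVolume n M U := by
  obtain ⟨x, hx⟩ := hne
  refine lt_of_lt_of_le ?_ (le_iSup (fun x : M => chartVolume n x) x U)
  rw [chartVolume, Measure.map_apply_of_aemeasurable (aemeasurable_chart_symm x) hU.measurableSet,
    pos_iff_ne_zero]
  intro h0
  have hmt := (chartAt 𝔼 x).open_target.measurableSet
  have hcont : ContinuousOn (fun y => ENNReal.ofReal (Real.sqrt (metricMatrix n x y).det))
      (chartAt 𝔼 x).target :=
    ENNReal.continuous_ofReal.comp_continuousOn (continuousOn_metricMatrix_det x).sqrt
  rw [withDensity_apply_eq_zero' (hcont.aemeasurable hmt), Measure.restrict_apply' hmt] at h0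
  have hopen := (chartAt 𝔼 x).symm.isOpen_inter_preimage hU
  refine (hopen.measure_pos volume ⟨chartAt 𝔼 x x, mem_chart_target _ x, ?_⟩).ne'
    (measure_mono_null ?_ h0)
  · simpa [(chartAt 𝔼 x).left_inv (mem_chart_source 𝔼 x)] using hx
  · rintro y ⟨hy, hyU⟩
    refine ⟨⟨?_, hyU⟩, hy⟩
    simpa using metricMatrix_det_pos x hy

/-- Rademacher's theorem on a Riemannian manifold. -/
lemma ae_mdifferentiableAt [CompactSpace M] [IsRiemannianManifold (𝓡 n) M] {u : M → ℝ} {K : ℝ≥0}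
    (hu : LipschitzWith K u) :
    ∀ᵐ x ∂(riemVolume n M), MDifferentiableAt (𝓡 n) 𝓘(ℝ, ℝ) u x := by
  rw [ae_iff]
  refine riemVolume_eq_zero (measurableSet_mdifferentiableAt u).compl fun x =>
    chartVolume_eq_zero x (measurableSet_mdifferentiableAt u).compl ?_
  -- The inverse chart is only locally Lipschitz, so the Euclidean Rademacher theorem is applied on
  -- small neighbourhoods.
  refine measure_null_of_locally_null _ fun y hy => ?_
  obtain ⟨C, s, hs, hlip⟩ := exists_lipschitzOnWith_chart_symm x hy.1
  obtain ⟨V, hVs, hV, hyV⟩ := mem_nhds_iff.1 hs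
  have hlip' : LipschitzOnWith (K * C) (u ∘ (chartAt 𝔼 x).symm) V :=
    hu.comp_lipschitzOnWith (hlip.mono hVs)
  refine ⟨_ ∩ V, inter_mem_nhdsWithin _ (hV.mem_nhds hyV), ?_⟩
  have := hlip'.ae_differentiableWithinAt_of_mem (μ := volume)
  refine measure_mono_null ?_ this
  rintro z ⟨⟨hz, hzd⟩, hzV⟩ h
  exact hzd ((mdifferentiableAt_chart_symm_iff x hz).2 ((h hzV).differentiableAt (hV.mem_nhds hzV)))

end Volume

/-! ### Calculus rules for the gradient -/

section Gradient

variable {n : ℕ} {M : Type*} [MetricSpace M]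
  [ChartedSpace (EuclideanSpace ℝ (Fin n)) M]
  [Bundle.RiemannianBundle (fun x : M => TangentSpace (𝓡 n) x)]

lemma grad_mul {u w : M → ℝ} {x : M} (hu : MDifferentiableAt (𝓡 n) 𝓘(ℝ, ℝ) u x)
    (hw : MDifferentiableAt (𝓡 n) 𝓘(ℝ, ℝ) w x) :
    MDifferentiableAt (𝓡 n) 𝓘(ℝ, ℝ) (fun z => u z * w z) x ∧
    grad n (fun z => u z * w z) x = u x • grad n w x + w x • grad n u x := by
  have h : HasMFDerivAt (𝓡 n) 𝓘(ℝ, ℝ) (fun z => u z * w z) x _ :=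
    hu.hasMFDerivAt.mul hw.hasMFDerivAt
  refine ⟨h.mdifferentiableAt, grad_eq_iff.2 fun v => ?_⟩
  have h1 : inner ℝ (u x • grad n w x + w x • grad n u x) v =
      u x * inner ℝ (grad n w x) v + w x * inner ℝ (grad n u x) v := by
    rw [inner_add_left, real_inner_smul_left, real_inner_smul_left]
  rw [inner_grad_eq_mfderiv w, inner_grad_eq_mfderiv u] at h1
  refine Eq.trans ?_ h1.symm
  exact congrArg (fun T : TangentSpace (𝓡 n) x →L[ℝ] ℝ => T v) h.mfderiv

lemma grad_add {u w : M → ℝ} {x : M} (hu : MDifferentiableAt (𝓡 n) 𝓘(ℝ, ℝ) u x)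
    (hw : MDifferentiableAt (𝓡 n) 𝓘(ℝ, ℝ) w x) :
    grad n (fun z => u z + w z) x = grad n u x + grad n w x := by
  have h : HasMFDerivAt (𝓡 n) 𝓘(ℝ, ℝ) (fun z => u z + w z) x _ :=
    hu.hasMFDerivAt.add hw.hasMFDerivAt
  refine grad_eq_iff.2 fun v => ?_
  have h1 := inner_add_left (𝕜 := ℝ) (grad n u x) (grad n w x) v
  rw [inner_grad_eq_mfderiv w, inner_grad_eq_mfderiv u] at h1
  refine Eq.trans ?_ h1.symm
  exact congrArg (fun T : TangentSpace (𝓡 n) x →L[ℝ] ℝ => T v) h.mfderiv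

lemma grad_comp {u : M → ℝ} {x : M} {F : ℝ → ℝ} {F' : ℝ}
    (hu : MDifferentiableAt (𝓡 n) 𝓘(ℝ, ℝ) u x) (hF : HasDerivAt F F' (u x)) :
    MDifferentiableAt (𝓡 n) 𝓘(ℝ, ℝ) (fun z => F (u z)) x ∧
    grad n (fun z => F (u z)) x = F' • grad n u x := by
  have h : HasMFDerivAt (𝓡 n) 𝓘(ℝ, ℝ) (fun z => F (u z)) x _ :=
    hF.hasFDerivAt.hasMFDerivAt.comp x hu.hasMFDerivAt
  refine ⟨h.mdifferentiableAt, grad_eq_iff.2 fun v => ?_⟩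
  have h1 : inner ℝ (F' • grad n u x) v = F' * inner ℝ (grad n u x) v := by
    rw [real_inner_smul_left]
  rw [inner_grad_eq_mfderiv u] at h1
  refine Eq.trans ?_ h1.symm
  refine (congrArg (fun T : TangentSpace (𝓡 n) x →L[ℝ] ℝ => T v) h.mfderiv).trans ?_
  exact mul_comm _ _

/-- Applied to a cutoff at each of its zeros, this confines the terms with `∇η` to the set outside
which `η` vanishes. -/
lemma grad_eq_zero_of_isMinOn [IsManifold (𝓡 n) ∞ M] {u : M → ℝ} {x : M} (h : ∀ z, u x ≤ u z) :
    grad n u x = 0 := by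
  by_cases hd : MDifferentiableAt (𝓡 n) 𝓘(ℝ, ℝ) u x
  swap
  · exact grad_of_not_mdifferentiableAt hd
  have hyt := mem_chart_target (EuclideanSpace ℝ (Fin n)) x
  have hφy := (chartAt (EuclideanSpace ℝ (Fin n)) x).left_inv
    (mem_chart_source (EuclideanSpace ℝ (Fin n)) x)
  rw [← hφy] at hd h ⊢
  generalize chartAt (EuclideanSpace ℝ (Fin n)) x x = y at hyt hd h ⊢
  obtain ⟨e, he⟩ : ∃ e : EuclideanSpace ℝ (Fin n),
      (mfderiv (𝓡 n) (𝓡 n) (chartAt (EuclideanSpace ℝ (Fin n)) x).symm y e :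
        TangentSpace (𝓡 n) ((chartAt (EuclideanSpace ℝ (Fin n)) x).symm y)) =
        grad n u ((chartAt (EuclideanSpace ℝ (Fin n)) x).symm y) :=
    (bijective_mfderiv_chart_symm x hyt).2 _
  have h1 := (hasFDerivAt_comp_chart_symm x hyt hd).2 e
  have h2 : IsLocalMin (u ∘ (chartAt (EuclideanSpace ℝ (Fin n)) x).symm) y :=
    Filter.Eventually.of_forall fun z => h _
  rw [h2.fderiv_eq_zero, he] at h1
  exact inner_self_eq_zero.1 h1.symm

end Gradient

/-! ### Bounded measurable functions and Hölder above a level -/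

section BddAEMeas

variable {X : Type*} [MeasurableSpace X] {μ : Measure X}

/-- An almost everywhere measurable function that is bounded. -/
def BddAEMeas (μ : Measure X) (g : X → ℝ) : Prop :=
  AEMeasurable g μ ∧ ∃ c, ∀ x, |g x| ≤ c

namespace BddAEMeas

variable {g h : X → ℝ}

lemma add (hg : BddAEMeas μ g) (hh : BddAEMeas μ h) : BddAEMeas μ (fun x => g x + h x) := by
  obtain ⟨hgm, c, hc⟩ := hg
  obtain ⟨hhm, d, hd⟩ := hh
  exact ⟨hgm.add hhm, c + d, fun x => (abs_add_le _ _).trans (add_le_add (hc x) (hd x))⟩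

lemma mul (hg : BddAEMeas μ g) (hh : BddAEMeas μ h) : BddAEMeas μ (fun x => g x * h x) := by
  obtain ⟨hgm, c, hc⟩ := hg
  obtain ⟨hhm, d, hd⟩ := hh
  refine ⟨hgm.mul hhm, c * d, fun x => ?_⟩
  rw [abs_mul]
  exact mul_le_mul (hc x) (hd x) (abs_nonneg _) ((abs_nonneg _).trans (hc x))

lemma const (c : ℝ) : BddAEMeas μ (fun _ => c) := ⟨aemeasurable_const, |c|, fun _ => le_rfl⟩

lemma sub (hg : BddAEMeas μ g) (hh : BddAEMeas μ h) : BddAEMeas μ (fun x => g x - h x) := by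
  simpa [sub_eq_add_neg] using hg.add ((const (-1)).mul hh)

lemma pow (hg : BddAEMeas μ g) (k : ℕ) : BddAEMeas μ (fun x => g x ^ k) := by
  obtain ⟨hgm, c, hc⟩ := hg
  refine ⟨hgm.pow_const k, c ^ k, fun x => ?_⟩
  rw [abs_pow]
  exact pow_le_pow_left₀ (abs_nonneg _) (hc x) k

lemma rpow (hg : BddAEMeas μ g) {s : ℝ} (hs : 0 ≤ s) : BddAEMeas μ (fun x => g x ^ s) := by
  obtain ⟨hgm, c, hc⟩ := hg
  refine ⟨hgm.pow_const s, c ^ s, fun x => ?_⟩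
  exact (Real.abs_rpow_le_abs_rpow _ _).trans (Real.rpow_le_rpow (abs_nonneg _) (hc x) hs)

lemma indicator (hg : BddAEMeas μ g) {s : Set X} (hs : MeasurableSet s) :
    BddAEMeas μ (s.indicator g) := by
  obtain ⟨hgm, c, hc⟩ := hg
  refine ⟨hgm.indicator hs, c, fun x => ?_⟩
  by_cases hx : x ∈ s
  · simpa [hx] using hc x
  · simpa [hx] using (abs_nonneg _).trans (hc x)

lemma memLp [IsFiniteMeasure μ] (hg : BddAEMeas μ g) (q : ℝ≥0∞) : MemLp g q μ := by
  obtain ⟨hgm, c, hc⟩ := hg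
  exact MemLp.of_bound hgm.aestronglyMeasurable c (Filter.Eventually.of_forall hc)

lemma integrable [IsFiniteMeasure μ] (hg : BddAEMeas μ g) : Integrable g μ :=
  memLp_one_iff_integrable.1 (hg.memLp 1)

lemma of_continuous [TopologicalSpace X] [CompactSpace X] [OpensMeasurableSpace X]
    (hg : Continuous g) : BddAEMeas μ g := by
  refine ⟨hg.measurable.aemeasurable, ?_⟩
  obtain ⟨c, hc⟩ := isCompact_univ.exists_bound_of_continuousOn hg.continuousOn
  exact ⟨c, fun x => hc x (mem_univ x)⟩

end BddAEMeas

/-- Hölder's inequality with exponents `ν/2` and `ν/(ν-2)`, applied where `f` exceeds `l`. -/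
lemma integral_mul_le_of_level [IsFiniteMeasure μ] {ν l : ℝ} (hν : 2 < ν) (hl0 : 0 ≤ l)
    {f w : X → ℝ}
    (hf : BddAEMeas μ f) (hw : BddAEMeas μ w) (hf0 : ∀ x, 0 ≤ f x) (hw0 : ∀ x, 0 ≤ w x)
    {s : Set X} (hs : MeasurableSet (s ∩ {x | l < f x})) (hws : ∀ x, x ∉ s → w x = 0) :
    ∫ x, f x * w x ∂μ ≤ l * ∫ x, w x ∂μ +
      (∫ x in s ∩ {x | l < f x}, f x ^ (ν / 2) ∂μ) ^ (2 / ν) *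
        (∫ x, w x ^ (ν / (ν - 2)) ∂μ) ^ ((ν - 2) / ν) := by
  have hν' : 0 < ν - 2 := by linarith
  have hconj : (ν / 2).HolderConjugate (ν / (ν - 2)) := by
    rw [Real.holderConjugate_iff]
    refine ⟨by linarith, ?_⟩
    field_simp
    ring
  have hH := integral_mul_le_Lp_mul_Lq_of_nonneg (μ := μ) hconj
    (f := (s ∩ {x | l < f x}).indicator f) (g := w)
    (Filter.Eventually.of_forall fun x => indicator_nonneg (fun y _ => hf0 y) x)
    (Filter.Eventually.of_forall hw0) ((hf.indicator hs).memLp _) (hw.memLp _)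
  have h1 : ∫ x, (s ∩ {x | l < f x}).indicator f x ^ (ν / 2) ∂μ =
      ∫ x in s ∩ {x | l < f x}, f x ^ (ν / 2) ∂μ := by
    rw [← integral_indicator hs]
    congr 1
    ext x
    by_cases hx : x ∈ s ∩ {x | l < f x}
    · simp only [indicator_of_mem hx]
    · simp only [indicator_of_notMem hx]
      exact Real.zero_rpow (by linarith)
  rw [h1, one_div_div, one_div_div] at hH
  refine le_trans ?_ (add_le_add_right hH _)
  rw [← integral_const_mul, ← integral_add ((BddAEMeas.const l).mul hw).integrable
    ((hf.indicator hs).mul hw).integrable]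
  refine integral_mono (hf.mul hw).integrable
    (((BddAEMeas.const l).mul hw).add ((hf.indicator hs).mul hw)).integrable fun x => ?_
  by_cases hx : x ∈ s
  swap
  · simp [hws x hx]
  have hw0x := hw0 x
  have hf0x := hf0 x
  by_cases hl : l < f x
  · have : x ∈ s ∩ {x | l < f x} := ⟨hx, hl⟩
    simp only [indicator_of_mem this]
    nlinarith
  · have : x ∉ s ∩ {x | l < f x} := fun h => hl h.2
    simp only [indicator_of_notMem this]
    nlinarith

end BddAEMeas

/-- The dictionary is `A = |∇f|²`, `B = ⟨∇f, ∇η⟩`, `C = |∇η|²`, `E = (f + δ)^(p-2)`, `a = p - 2`.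
With `t = f/(f + δ)` in `[0, 1]`, the good coefficient `1 + a t - θ₁` is at least `1 - 1/2 - 1/4 =
1/4`. Young's inequality spends `1/8` of it on the cross term and `1/8` survives. -/
lemma caccioppoli_pointwise {θ₁ θ₂ θ₃ a η f δ A B C E : ℝ} (hθ : θ₁ ≤ 1 / 4) (ha : -(1 / 2) ≤ a)
    (hf : 0 ≤ f) (hδ : 0 < δ) (hA : 0 ≤ A) (hC : 0 ≤ C) (hB : B ^ 2 ≤ A * C)
    (hE : 0 ≤ E) :
    η ^ 2 * E * (θ₁ * A + θ₂ * f ^ 2 + θ₃ * f ^ 3)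
        - ((η ^ 2 * E + a * η ^ 2 * f * (E / (f + δ))) * A + 2 * η * f * E * B) ≤
      -(1 / 8) * (η ^ 2 * E * A) + 8 * (C * (E * (f + δ) ^ 2)) +
        |θ₂| * (η ^ 2 * (E * (f + δ) ^ 2)) + |θ₃| * (f * (η ^ 2 * (E * (f + δ) ^ 2))) := by
  set F := f + δ with hF
  have hFpos : 0 < F := by positivity
  have hfF : f ≤ F := by linarith
  set t := f / F with ht
  have ht0 : 0 ≤ t := by positivity
  have ht1 : t ≤ 1 := (div_le_one hFpos).2 hfF
  have hat : -(1 / 2) ≤ a * t := by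
    rcases le_total 0 a with h | h
    · have := mul_nonneg h ht0; linarith
    · nlinarith
  have hf2 : f ^ 2 ≤ F ^ 2 := pow_le_pow_left₀ hf hfF 2
  have hyoung : -(2 * η * f * B) ≤ (1 / 8) * (η ^ 2 * A) + 8 * (C * f ^ 2) := by
    have h1 : (2 * η * f * B) ^ 2 ≤ ((1 / 8) * (η ^ 2 * A) + 8 * (C * f ^ 2)) ^ 2 := by
      have h2 : η ^ 2 * f ^ 2 * B ^ 2 ≤ η ^ 2 * f ^ 2 * (A * C) := by gcongr
      nlinarith [sq_nonneg ((1 / 8) * (η ^ 2 * A) - 8 * (C * f ^ 2))]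
    exact (neg_le_abs _).trans (abs_le_of_sq_le_sq h1 (by positivity))
  have e1 : η ^ 2 * A * θ₁ ≤ η ^ 2 * A * (1 / 4) := by gcongr
  have e2 : η ^ 2 * A * (-(1 / 2)) ≤ η ^ 2 * A * (a * t) := by gcongr
  have e3 : η ^ 2 * (θ₂ * f ^ 2) ≤ |θ₂| * (η ^ 2 * F ^ 2) := by
    calc η ^ 2 * (θ₂ * f ^ 2) ≤ η ^ 2 * (|θ₂| * F ^ 2) := by
          gcongr
          exact le_abs_self _
      _ = _ := by ring
  have e4 : η ^ 2 * (θ₃ * f ^ 3) ≤ |θ₃| * (f * (η ^ 2 * F ^ 2)) := by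
    calc η ^ 2 * (θ₃ * f ^ 3) = η ^ 2 * (f * (θ₃ * f ^ 2)) := by ring
      _ ≤ η ^ 2 * (f * (|θ₃| * F ^ 2)) := by
          gcongr
          exact le_abs_self _
      _ = _ := by ring
  have e5 : C * f ^ 2 ≤ C * F ^ 2 := by gcongr
  have hlhs : η ^ 2 * E * (θ₁ * A + θ₂ * f ^ 2 + θ₃ * f ^ 3)
        - ((η ^ 2 * E + a * η ^ 2 * f * (E / F)) * A + 2 * η * f * E * B) =
      E * (η ^ 2 * A * θ₁ + η ^ 2 * (θ₂ * f ^ 2) + η ^ 2 * (θ₃ * f ^ 3) - η ^ 2 * A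
        - η ^ 2 * A * (a * t) + -(2 * η * f * B)) := by
    rw [ht]; ring
  have hrhs : -(1 / 8) * (η ^ 2 * E * A) + 8 * (C * (E * F ^ 2)) +
        |θ₂| * (η ^ 2 * (E * F ^ 2)) + |θ₃| * (f * (η ^ 2 * (E * F ^ 2))) =
      E * (-(1 / 8) * (η ^ 2 * A) + 8 * (C * F ^ 2) + |θ₂| * (η ^ 2 * F ^ 2) +
        |θ₃| * (f * (η ^ 2 * F ^ 2))) := by ring
  rw [hlhs, hrhs]
  exact mul_le_mul_of_nonneg_left (by linarith) hE

lemma BddAEMeas.integral_linear_combination {X : Type*} [MeasurableSpace X] {μ : Measure X}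
    [IsFiniteMeasure μ] {g₁ g₂ g₃ g₄ : X → ℝ} {c₁ c₂ c₃ c₄ : ℝ} (h₁ : BddAEMeas μ g₁)
    (h₂ : BddAEMeas μ g₂) (h₃ : BddAEMeas μ g₃) (h₄ : BddAEMeas μ g₄) :
    ∫ x, (c₁ * g₁ x + c₂ * g₂ x + c₃ * g₃ x + c₄ * g₄ x) ∂μ =
      c₁ * ∫ x, g₁ x ∂μ + c₂ * ∫ x, g₂ x ∂μ + c₃ * ∫ x, g₃ x ∂μ + c₄ * ∫ x, g₄ x ∂μ := by
  have i₁ := ((const c₁).mul h₁)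
  have i₂ := ((const c₂).mul h₂)
  have i₃ := ((const c₃).mul h₃)
  have i₄ := ((const c₄).mul h₄)
  rw [integral_add ((i₁.add i₂).add i₃).integrable i₄.integrable,
    integral_add (i₁.add i₂).integrable i₃.integrable,
    integral_add i₁.integrable i₂.integrable]
  simp only [integral_const_mul]

/-! ### Lipschitz test functions and cutoffs -/

section Lipschitz

variable {X : Type*} [MetricSpace X] [CompactSpace X]

lemma exists_lipschitzWith_mul {u w : X → ℝ} (hu : ∃ K : ℝ≥0, LipschitzWith K u)
    (hw : ∃ K : ℝ≥0, LipschitzWith K w) : ∃ K : ℝ≥0, LipschitzWith K (fun x => u x * w x) := by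
  obtain ⟨K, hK⟩ := hu
  obtain ⟨L, hL⟩ := hw
  obtain ⟨c, hc⟩ := isCompact_univ.exists_bound_of_continuousOn hK.continuous.continuousOn
  obtain ⟨d, hd⟩ := isCompact_univ.exists_bound_of_continuousOn hL.continuous.continuousOn
  refine ⟨Real.toNNReal (|c| * L + |d| * K), LipschitzWith.of_dist_le_mul fun x y => ?_⟩
  have h1 := hK.dist_le_mul x y
  have h2 := hL.dist_le_mul x y
  have hcx : |u x| ≤ |c| := (hc x (mem_univ x)).trans (le_abs_self c)
  have hdy : |w y| ≤ |d| := (hd y (mem_univ y)).trans (le_abs_self d)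
  rw [Real.dist_eq] at h1 h2 ⊢
  rw [Real.coe_toNNReal _ (by positivity)]
  calc |u x * w x - u y * w y| = |u x * (w x - w y) + w y * (u x - u y)| := by ring_nf
    _ ≤ |u x| * |w x - w y| + |w y| * |u x - u y| := by
      simpa only [abs_mul] using abs_add_le (u x * (w x - w y)) (w y * (u x - u y))
    _ ≤ |c| * (L * dist x y) + |d| * (K * dist x y) := by gcongr
    _ = _ := by ring

/-- The values of `u` lie in a compact interval away from zero, on which `t ^ s` is `C¹`. This is
why `f` is replaced by `f + δ`: the exponent `p - 2` may be negative. -/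
lemma exists_lipschitzWith_rpow {u : X → ℝ} (hu : ∃ K : ℝ≥0, LipschitzWith K u)
    {δ : ℝ} (hδ : 0 < δ) (h : ∀ x, δ ≤ u x) (s : ℝ) :
    ∃ K : ℝ≥0, LipschitzWith K (fun x => u x ^ s) := by
  obtain ⟨K, hK⟩ := hu
  obtain ⟨c, hc⟩ := isCompact_univ.exists_bound_of_continuousOn hK.continuous.continuousOn
  have hcd : ContDiffOn ℝ 1 (fun t : ℝ => t ^ s) (Icc δ c) := fun t ht =>
    (Real.contDiffAt_rpow_const_of_ne (hδ.trans_le ht.1).ne').contDiffWithinAt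
  obtain ⟨L, hL⟩ := hcd.exists_lipschitzOnWith one_ne_zero (convex_Icc _ _) isCompact_Icc
  refine ⟨L * K, ?_⟩
  rw [← lipschitzOnWith_univ]
  exact hL.comp (hK.lipschitzOnWith (s := univ)) fun x _ =>
    ⟨h x, (le_abs_self _).trans (hc x (mem_univ x))⟩

omit [CompactSpace X] in
lemma exists_cutoff (P : X) {R' R : ℝ} (h : R' < R) : ∃ η : X → ℝ,
    LipschitzWith (Real.toNNReal (1 / (R - R'))) η ∧ (∀ x, 0 ≤ η x) ∧ (∀ x, η x ≤ 1) ∧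
      (∀ x ∈ Metric.ball P R', η x = 1) ∧ ∀ x, x ∉ Metric.ball P R → η x = 0 := by
  have hpos : 0 < R - R' := sub_pos.2 h
  refine ⟨fun x => max 0 (min 1 ((R - dist x P) / (R - R'))), ?_, fun x => le_max_left _ _,
    fun x => max_le zero_le_one (min_le_left _ _), fun x hx => ?_, fun x hx => ?_⟩
  · have h1 : LipschitzWith (Real.toNNReal (1 / (R - R')))
        (fun x : X => (R - dist x P) / (R - R')) := by
      refine LipschitzWith.of_dist_le_mul fun x y => ?_
      rw [Real.coe_toNNReal _ (by positivity), Real.dist_eq, ← sub_div, abs_div,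
        abs_of_pos hpos, div_eq_inv_mul, one_div]
      gcongr
      rw [sub_sub_sub_cancel_left, abs_sub_comm]
      exact abs_dist_sub_le x y P
    exact (h1.const_min 1).const_max 0
  · rw [Metric.mem_ball] at hx
    have : 1 ≤ (R - dist x P) / (R - R') := (one_le_div hpos).2 (by linarith)
    simp [min_eq_left this]
  · rw [Metric.mem_ball, not_lt] at hx
    have : (R - dist x P) / (R - R') ≤ 0 := div_nonpos_of_nonpos_of_nonneg (by linarith) hpos.le
    exact max_eq_left ((min_le_right _ _).trans this)

end Lipschitz

/-! ### The Caccioppoli inequality -/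

section Energy

variable {n : ℕ} {M : Type*} [MetricSpace M] [CompactSpace M]
  [ChartedSpace (EuclideanSpace ℝ (Fin n)) M] [IsManifold (𝓡 n) ∞ M]
  [Bundle.RiemannianBundle (fun x : M => TangentSpace (𝓡 n) x)]
  [IsContinuousRiemannianBundle (EuclideanSpace ℝ (Fin n)) (fun x : M => TangentSpace (𝓡 n) x)]
  [IsRiemannianManifold (𝓡 n) M] [MeasurableSpace M] [BorelSpace M]

lemma BddAEMeas.norm_grad {u : M → ℝ} (hu : ∃ K : ℝ≥0, LipschitzWith K u) :
    BddAEMeas (riemVolume n M) (fun x => ‖grad n u x‖) := by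
  obtain ⟨K, hK⟩ := hu
  exact ⟨(measurable_norm_grad u).aemeasurable, K, fun x => by
    simpa using norm_grad_le (n := n) hK x⟩

/-- Measurability follows by polarization from that of gradient norms. The identity needs both
functions differentiable, so it holds only almost everywhere. -/
lemma BddAEMeas.inner_grad {u w : M → ℝ} (hu : ∃ K : ℝ≥0, LipschitzWith K u)
    (hw : ∃ K : ℝ≥0, LipschitzWith K w) :
    BddAEMeas (riemVolume n M) (fun x => inner ℝ (grad n u x) (grad n w x)) := by
  obtain ⟨c, hc⟩ := ((norm_grad (n := n) hu).mul (norm_grad (n := n) hw)).2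
  obtain ⟨K, hK⟩ := hu
  obtain ⟨L, hL⟩ := hw
  refine ⟨?_, c, fun x => (abs_real_inner_le_norm _ _).trans ((le_abs_self _).trans (hc x))⟩
  have h1 := measurable_norm_grad (n := n) (fun x => u x + w x)
  refine AEMeasurable.congr (f := fun x => (‖grad n (fun x => u x + w x) x‖ ^ 2 -
    ‖grad n u x‖ ^ 2 - ‖grad n w x‖ ^ 2) / 2) (by
      have h2 := measurable_norm_grad (n := n) u
      have h3 := measurable_norm_grad (n := n) w
      fun_prop) ?_
  filter_upwards [ae_mdifferentiableAt hK, ae_mdifferentiableAt hL] with x hx hx'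
  rw [grad_add hx hx', norm_add_sq_real]
  ring

/-- The weak inequality is tested with `φ = η² (f + δ)^(p-2)`. After expansion of `∇(φ f)` the
pointwise estimate is integrated, and its gradient term is moved to the left and multiplied by `8`.
-/
lemma caccioppoli [IsFiniteMeasure (riemVolume n M)] {f η : M → ℝ} {θ₁ θ₂ θ₃ p δ : ℝ} {G : ℝ≥0}
    (hθ : θ₁ ≤ 1 / 4) (hp : 3 / 2 ≤ p) (hδ : 0 < δ) (hf : ∃ K : ℝ≥0, LipschitzWith K f)
    (hf0 : ∀ x, 0 ≤ f x) (hW : WeakDiffIneq n θ₁ θ₂ θ₃ f) (hη : LipschitzWith G η)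
    (hη0 : ∀ x, 0 ≤ η x) {s : Set M} (hs : MeasurableSet s) (hηs : ∀ x, x ∉ s → η x = 0) :
    ∫ x, η x ^ 2 * (f x + δ) ^ (p - 2) * ‖grad n f x‖ ^ 2 ∂(riemVolume n M) ≤
      64 * G ^ 2 * ∫ x in s, (f x + δ) ^ p ∂(riemVolume n M) +
        8 * |θ₂| * ∫ x, η x ^ 2 * (f x + δ) ^ p ∂(riemVolume n M) +
        8 * |θ₃| * ∫ x, f x * (η x ^ 2 * (f x + δ) ^ p) ∂(riemVolume n M) := by
  set μ := riemVolume n M with hμ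
  have hFδ : ∀ x, δ ≤ f x + δ := fun x => le_add_of_nonneg_left (hf0 x)
  have hFpos : ∀ x, 0 < f x + δ := fun x => hδ.trans_le (hFδ x)
  have hF : ∃ K : ℝ≥0, LipschitzWith K (fun x => f x + δ) := by
    obtain ⟨K, hK⟩ := hf
    exact ⟨K + 0, hK.add (LipschitzWith.const δ)⟩
  have hη' : ∃ K : ℝ≥0, LipschitzWith K η := ⟨G, hη⟩
  have hE := exists_lipschitzWith_rpow hF hδ hFδ (p - 2)
  have hφ : ∃ K : ℝ≥0, LipschitzWith K (fun x => η x * η x * (f x + δ) ^ (p - 2)) :=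
    exists_lipschitzWith_mul (exists_lipschitzWith_mul hη' hη') hE
  have hc : ∀ {u : M → ℝ}, (∃ K : ℝ≥0, LipschitzWith K u) → BddAEMeas μ u :=
    fun ⟨K, hK⟩ => BddAEMeas.of_continuous hK.continuous
  have hA := (BddAEMeas.norm_grad (n := n) hf).pow 2
  have hB := BddAEMeas.inner_grad (n := n) hf hη'
  have hEF : ∀ x, (f x + δ) ^ (p - 2) * (f x + δ) ^ 2 = (f x + δ) ^ p := fun x => by
    rw [← Real.rpow_natCast, ← Real.rpow_add (hFpos x)]
    norm_num
  have hinv : BddAEMeas μ (fun x => (f x + δ) ^ (p - 2) / (f x + δ)) := by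
    have := hc (exists_lipschitzWith_rpow hF hδ hFδ (p - 2 - 1))
    simpa only [Real.rpow_sub_one (hFpos _).ne'] using this
  have hFp : BddAEMeas μ (fun x => (f x + δ) ^ p) := hc (exists_lipschitzWith_rpow hF hδ hFδ p)
  have hfb := hc hf
  have hηb := hc hη'
  have hEb := hc hE
  have hW' := hW _ hφ fun x => mul_nonneg (mul_nonneg (hη0 x) (hη0 x))
    (Real.rpow_nonneg (hFpos x).le _)
  set T : M → ℝ := fun x => (η x ^ 2 * (f x + δ) ^ (p - 2) + (p - 2) * η x ^ 2 * f x *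
    ((f x + δ) ^ (p - 2) / (f x + δ))) * ‖grad n f x‖ ^ 2 +
      2 * η x * f x * (f x + δ) ^ (p - 2) * inner ℝ (grad n f x) (grad n η x) with hT
  have hTb : BddAEMeas μ T :=
    ((((hηb.pow 2).mul hEb).add (((((BddAEMeas.const (p - 2)).mul (hηb.pow 2)).mul hfb).mul
      hinv))).mul hA).add (((((BddAEMeas.const 2).mul hηb).mul hfb).mul hEb).mul hB)
  set Z : M → ℝ := fun x => η x ^ 2 * (f x + δ) ^ (p - 2) *
    (θ₁ * ‖grad n f x‖ ^ 2 + θ₂ * f x ^ 2 + θ₃ * f x ^ 3) with hZ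
  have hZb : BddAEMeas μ Z := ((hηb.pow 2).mul hEb).mul
    ((((BddAEMeas.const θ₁).mul hA).add ((BddAEMeas.const θ₂).mul (hfb.pow 2))).add
      ((BddAEMeas.const θ₃).mul (hfb.pow 3)))
  have hTint : ∫ x, inner ℝ (grad n f x)
      (grad n (fun z => η z * η z * (f z + δ) ^ (p - 2) * f z) x) ∂μ = ∫ x, T x ∂μ := by
    refine integral_congr_ae ?_
    obtain ⟨K, hK⟩ := hf
    filter_upwards [ae_mdifferentiableAt hK, ae_mdifferentiableAt hη] with x hx hx'
    have h1 := grad_mul hx' hx'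
    have h2 := grad_comp hx ((((hasDerivAt_id (f x)).add_const δ).rpow_const (p := p - 2)
      (Or.inl (hFpos x).ne')))
    have h3 := grad_mul h1.1 h2.1
    have h4 := grad_mul h3.1 hx
    simp only [id] at h2 h3 h4
    rw [h4.2, h3.2, h2.2, h1.2, Real.rpow_sub_one (hFpos x).ne']
    simp only [inner_add_right, real_inner_smul_right, real_inner_self_eq_norm_sq, hT]
    ring
  have hZint : ∫ x, η x * η x * (f x + δ) ^ (p - 2) * (-θ₁ * ‖grad n f x‖ ^ 2 - θ₂ * f x ^ 2 -
      θ₃ * f x ^ 3) ∂μ = -∫ x, Z x ∂μ := by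
    rw [← integral_neg]
    refine integral_congr_ae (Filter.Eventually.of_forall fun x => ?_)
    simp only [hZ]
    ring
  rw [hTint, hZint] at hW'
  have hwb : BddAEMeas μ (fun x => η x ^ 2 * (f x + δ) ^ p) := (hηb.pow 2).mul hFp
  have hmain : ∫ x, (Z x - T x) ∂μ ≤
      ∫ x, (-(1 / 8) * (η x ^ 2 * (f x + δ) ^ (p - 2) * ‖grad n f x‖ ^ 2) +
      8 * G ^ 2 * s.indicator (fun x => (f x + δ) ^ p) x + |θ₂| * (η x ^ 2 * (f x + δ) ^ p) +
        |θ₃| * (f x * (η x ^ 2 * (f x + δ) ^ p))) ∂μ := by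
    refine integral_mono (hZb.sub hTb).integrable ?_ fun x => ?_
    · exact (((((BddAEMeas.const _).mul (((hηb.pow 2).mul hEb).mul hA)).add
        ((BddAEMeas.const _).mul (hFp.indicator hs))).add ((BddAEMeas.const _).mul hwb)).add
        ((BddAEMeas.const _).mul (hfb.mul hwb))).integrable
    · have hpt := caccioppoli_pointwise (θ₂ := θ₂) (θ₃ := θ₃) (a := p - 2) (η := η x) (f := f x)
        (C := ‖grad n η x‖ ^ 2) (B := inner ℝ (grad n f x) (grad n η x))
        (A := ‖grad n f x‖ ^ 2) (E := (f x + δ) ^ (p - 2)) hθ (by linarith) (hf0 x)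
        hδ (sq_nonneg _) (sq_nonneg _) (by
          rw [← mul_pow, ← sq_abs]
          exact pow_le_pow_left₀ (abs_nonneg _) (abs_real_inner_le_norm _ _) 2)
        (Real.rpow_nonneg (hFpos x).le _)
      rw [hEF] at hpt
      have hC : ‖grad n η x‖ ^ 2 * (f x + δ) ^ p ≤
          G ^ 2 * s.indicator (fun x => (f x + δ) ^ p) x := by
        by_cases hx : x ∈ s
        · rw [indicator_of_mem hx]
          have := norm_grad_le (n := n) hη x
          have h0 := Real.rpow_nonneg (hFpos x).le p
          gcongr
        · rw [indicator_of_notMem hx,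
            grad_eq_zero_of_isMinOn fun z => by rw [hηs x hx]; exact hη0 z]
          simp
      simp only [hZ, hT]
      linarith
  rw [integral_sub hZb.integrable hTb.integrable,
    BddAEMeas.integral_linear_combination (((hηb.pow 2).mul hEb).mul hA) (hFp.indicator hs) hwb
      (hfb.mul hwb), integral_indicator hs] at hmain
  linarith

end Energy

/-! ### Reverse Hölder inequality with truncation level -/

section ReverseHolder

variable {n : ℕ} {M : Type*} [MetricSpace M] [CompactSpace M]
  [ChartedSpace (EuclideanSpace ℝ (Fin n)) M] [IsManifold (𝓡 n) ∞ M]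
  [Bundle.RiemannianBundle (fun x : M => TangentSpace (𝓡 n) x)]
  [IsContinuousRiemannianBundle (EuclideanSpace ℝ (Fin n)) (fun x : M => TangentSpace (𝓡 n) x)]
  [IsRiemannianManifold (𝓡 n) M] [MeasurableSpace M] [BorelSpace M]

omit [IsContinuousRiemannianBundle (EuclideanSpace ℝ (Fin n)) (fun x : M => TangentSpace (𝓡 n) x)]
  [CompactSpace M] [IsManifold (𝓡 n) ∞ M] [IsRiemannianManifold (𝓡 n) M] [BorelSpace M] in
lemma SobolevInequality.sq_le (hn : 3 ≤ n) {σ Cs c w : ℝ} (hc : 0 < c) (hCs : c ≤ Cs)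
    (hw : totalVolume n M ^ (-σ) ≤ w) (hS : SobolevInequality n M σ Cs) {u : M → ℝ}
    (hu : ∃ K : ℝ≥0, LipschitzWith K u) :
    (∫ x, (u x ^ 2) ^ ((n : ℝ) / ((n : ℝ) - 2)) ∂(riemVolume n M)) ^ (((n : ℝ) - 2) / (n : ℝ)) ≤
      2 / c ^ 2 * ∫ x, ‖grad n u x‖ ^ 2 ∂(riemVolume n M) +
        2 * w ^ 2 * ∫ x, u x ^ 2 ∂(riemVolume n M) := by
  have hn' : (3 : ℝ) ≤ n := by exact_mod_cast hn
  have h := hS u hu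
  have e1 : ∀ x, |u x| ^ (2 * (n : ℝ) / ((n : ℝ) - 2)) = (u x ^ 2) ^ ((n : ℝ) / ((n : ℝ) - 2)) := by
    intro x
    rw [← sq_abs, ← Real.rpow_natCast |u x| 2, ← Real.rpow_mul (abs_nonneg _)]
    congr 1
    push_cast
    ring
  simp only [e1, sq_abs] at h
  set L := ∫ x, (u x ^ 2) ^ ((n : ℝ) / ((n : ℝ) - 2)) ∂(riemVolume n M) with hL
  set D := ∫ x, ‖grad n u x‖ ^ 2 ∂(riemVolume n M) with hD
  set U := ∫ x, u x ^ 2 ∂(riemVolume n M) with hU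
  have hL0 : 0 ≤ L := integral_nonneg fun x => Real.rpow_nonneg (sq_nonneg _) _
  have hD0 : 0 ≤ D := integral_nonneg fun x => sq_nonneg _
  have hU0 : 0 ≤ U := integral_nonneg fun x => sq_nonneg _
  have hV0 : 0 ≤ totalVolume n M ^ (-σ) := Real.rpow_nonneg measureReal_nonneg _
  have hCs0 : 0 < Cs := hc.trans_le hCs
  have h2 : L ^ (((n : ℝ) - 2) / (2 * n)) ≤ 1 / c * D ^ (1 / 2 : ℝ) + w * U ^ (1 / 2 : ℝ) := by
    refine h.trans ?_
    gcongr
  have e2 : L ^ (((n : ℝ) - 2) / n) = (L ^ (((n : ℝ) - 2) / (2 * n))) ^ 2 := by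
    rw [← Real.rpow_natCast, ← Real.rpow_mul hL0]
    congr 1
    push_cast
    field_simp
  have e3 : ∀ t : ℝ, 0 ≤ t → (t ^ (1 / 2 : ℝ)) ^ 2 = t := fun t ht => by
    rw [← Real.sqrt_eq_rpow, Real.sq_sqrt ht]
  rw [e2]
  calc _ ≤ (1 / c * D ^ (1 / 2 : ℝ) + w * U ^ (1 / 2 : ℝ)) ^ 2 :=
        pow_le_pow_left₀ (Real.rpow_nonneg hL0 _) h2 2
    _ ≤ 2 * (1 / c * D ^ (1 / 2 : ℝ)) ^ 2 + 2 * (w * U ^ (1 / 2 : ℝ)) ^ 2 := by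
        nlinarith [sq_nonneg (1 / c * D ^ (1 / 2 : ℝ) - w * U ^ (1 / 2 : ℝ))]
    _ = _ := by
        rw [mul_pow, mul_pow, e3 D hD0, e3 U hU0]
        ring

/-- The constant of the reverse Hölder inequality. -/
noncomputable def stepConst (c θ₂ θ₃ w : ℝ) : ℝ :=
  4 / c ^ 2 * (34 + 4 * |θ₂| + 4 * |θ₃|) + 4 * w ^ 2

lemma stepConst_pos {c : ℝ} (hc : 0 < c) (θ₂ θ₃ w : ℝ) : 0 < stepConst c θ₂ θ₃ w := by
  unfold stepConst
  positivity

/-- Arithmetic of the absorption, with `F = f + δ`: `S` is the `L^κ` norm of `η² F^p`, `D` the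
energy of `η F^(p/2)`, and `Q`, `U`, `N`, `I` are the integrals of `η² F^(p-2) |∇f|²`, `η² F^p`, `f
η² F^p` and, over `s`, `F^p`. Chaining the bounds, `S` reappears on the right with coefficient `8 T₃
p² y / c²`, which `hy` makes at most `1/2`. -/
lemma absorb {c T₂ T₃ w p G l y S D Q U N I : ℝ} (hc : 0 < c) (hT₂ : 0 ≤ T₂) (hT₃ : 0 ≤ T₃)
    (hp : 1 ≤ p) (hl : 0 ≤ l) (hS0 : 0 ≤ S) (hUI : U ≤ I) (hI : 0 ≤ I)
    (hS : S ≤ 2 / c ^ 2 * D + 2 * w ^ 2 * U) (hD : D ≤ p ^ 2 / 2 * Q + 2 * G ^ 2 * I)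
    (hQ : Q ≤ 64 * G ^ 2 * I + 8 * T₂ * U + 8 * T₃ * N) (hN : N ≤ l * U + y * S)
    (hy : 16 * T₃ / c ^ 2 * p ^ 2 * y ≤ 1) :
    S ≤ (4 / c ^ 2 * (34 + 4 * T₂ + 4 * T₃) + 4 * w ^ 2) * p ^ 2 * (G ^ 2 + 1 + l) * I := by
  have hp2 : 1 ≤ p ^ 2 := one_le_pow₀ hp
  set k := 1 / c ^ 2 with hk
  have hk0 : 0 ≤ k := by positivity
  have e1 : 2 / c ^ 2 = 2 * k := by rw [hk]; ring
  have e2 : 4 / c ^ 2 = 4 * k := by rw [hk]; ring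
  have e3 : 16 * T₃ / c ^ 2 = 16 * T₃ * k := by rw [hk]; ring
  rw [e1] at hS
  rw [e2]
  rw [e3] at hy
  have hN' : N ≤ l * I + y * S := hN.trans (by gcongr)
  have hQ' : Q ≤ 64 * G ^ 2 * I + 8 * T₂ * I + 8 * T₃ * (l * I + y * S) := by
    refine hQ.trans ?_
    gcongr
  have hS' : S ≤ 2 * k * (p ^ 2 / 2 * (64 * G ^ 2 * I + 8 * T₂ * I + 8 * T₃ * (l * I + y * S)) +
      2 * G ^ 2 * I) + 2 * w ^ 2 * I := by
    refine hS.trans ?_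
    have : D ≤ p ^ 2 / 2 * (64 * G ^ 2 * I + 8 * T₂ * I + 8 * T₃ * (l * I + y * S)) +
      2 * G ^ 2 * I := hD.trans (by gcongr)
    gcongr
  have hyS : 16 * T₃ * k * p ^ 2 * y * S ≤ S := by
    simpa using mul_le_mul_of_nonneg_right hy hS0
  have h1 : S ≤ k * (128 * p ^ 2 * G ^ 2 + 16 * p ^ 2 * T₂ + 16 * p ^ 2 * T₃ * l + 8 * G ^ 2) * I +
      4 * w ^ 2 * I := by linarith
  refine h1.trans ?_
  have h2 : 8 * G ^ 2 ≤ 8 * p ^ 2 * G ^ 2 := by nlinarith [sq_nonneg G]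
  have h3 : 4 * w ^ 2 ≤ 4 * w ^ 2 * (p ^ 2 * (G ^ 2 + 1 + l)) := by
    have : 1 ≤ p ^ 2 * (G ^ 2 + 1 + l) := by nlinarith [sq_nonneg G]
    nlinarith [sq_nonneg w]
  have h4 : 128 * p ^ 2 * G ^ 2 + 16 * p ^ 2 * T₂ + 16 * p ^ 2 * T₃ * l + 8 * G ^ 2 ≤
      4 * (34 + 4 * T₂ + 4 * T₃) * (p ^ 2 * (G ^ 2 + 1 + l)) := by
    have a1 : 0 ≤ p ^ 2 * (34 * (1 + l)) := by positivity
    have a2 : 0 ≤ p ^ 2 * (T₂ * (G ^ 2 + l)) := by positivity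
    have a3 : 0 ≤ p ^ 2 * (T₃ * (G ^ 2 + 1)) := by positivity
    nlinarith
  calc _ ≤ k * (4 * (34 + 4 * T₂ + 4 * T₃) * (p ^ 2 * (G ^ 2 + 1 + l))) * I +
        4 * w ^ 2 * (p ^ 2 * (G ^ 2 + 1 + l)) * I := by gcongr
    _ = _ := by ring

lemma weighted_reverse_holder [IsFiniteMeasure (riemVolume n M)] (hn : 3 ≤ n) {f η : M → ℝ}
    {σ Cs c w θ₁ θ₂ θ₃ p δ l : ℝ} {G : ℝ≥0} (hc : 0 < c) (hCs : c ≤ Cs)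
    (hw : totalVolume n M ^ (-σ) ≤ w) (hS : SobolevInequality n M σ Cs)
    (hθ : θ₁ ≤ 1 / 4) (hp : 3 / 2 ≤ p) (hδ : 0 < δ) (hl : 0 ≤ l) (hf : ∃ K : ℝ≥0, LipschitzWith K f)
    (hf0 : ∀ x, 0 ≤ f x) (hW : WeakDiffIneq n θ₁ θ₂ θ₃ f) (hη : LipschitzWith G η)
    (hη0 : ∀ x, 0 ≤ η x) (hη1 : ∀ x, η x ≤ 1) {s : Set M} (hs : MeasurableSet s)
    (hηs : ∀ x, x ∉ s → η x = 0)
    (hy : 16 * |θ₃| / c ^ 2 * p ^ 2 *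
      (∫ x in s ∩ {x | l < f x}, f x ^ ((n : ℝ) / 2) ∂(riemVolume n M)) ^ (2 / (n : ℝ)) ≤ 1) :
    (∫ x, (η x ^ 2 * (f x + δ) ^ p) ^ ((n : ℝ) / ((n : ℝ) - 2)) ∂(riemVolume n M)) ^
        (((n : ℝ) - 2) / (n : ℝ)) ≤
      stepConst c θ₂ θ₃ w * p ^ 2 * (G ^ 2 + 1 + l) *
        ∫ x in s, (f x + δ) ^ p ∂(riemVolume n M) := by
  have hn' : (3 : ℝ) ≤ n := by exact_mod_cast hn
  have hFδ : ∀ x, δ ≤ f x + δ := fun x => le_add_of_nonneg_left (hf0 x)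
  have hFpos : ∀ x, 0 < f x + δ := fun x => hδ.trans_le (hFδ x)
  have hF : ∃ K : ℝ≥0, LipschitzWith K (fun x => f x + δ) := by
    obtain ⟨K, hK⟩ := hf
    exact ⟨K + 0, hK.add (LipschitzWith.const δ)⟩
  have hc' : ∀ {u : M → ℝ}, (∃ K : ℝ≥0, LipschitzWith K u) → BddAEMeas (riemVolume n M) u :=
    fun ⟨K, hK⟩ => BddAEMeas.of_continuous hK.continuous
  have hη' : ∃ K : ℝ≥0, LipschitzWith K η := ⟨G, hη⟩
  have hu : ∃ K : ℝ≥0, LipschitzWith K (fun x => η x * (f x + δ) ^ (p / 2)) :=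
    exists_lipschitzWith_mul hη' (exists_lipschitzWith_rpow hF hδ hFδ (p / 2))
  have hFp : BddAEMeas (riemVolume n M) (fun x => (f x + δ) ^ p) :=
    hc' (exists_lipschitzWith_rpow hF hδ hFδ p)
  have hwb : BddAEMeas (riemVolume n M) (fun x => η x ^ 2 * (f x + δ) ^ p) :=
    ((hc' hη').pow 2).mul hFp
  have hA := (BddAEMeas.norm_grad (n := n) hf).pow 2
  have hEb := hc' (exists_lipschitzWith_rpow hF hδ hFδ (p - 2))
  have hw0 : ∀ x, 0 ≤ η x ^ 2 * (f x + δ) ^ p := fun x =>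
    mul_nonneg (sq_nonneg _) (Real.rpow_nonneg (hFpos x).le _)
  have hrp : ∀ x, ∀ q : ℝ, ((f x + δ) ^ (q / 2)) ^ 2 = (f x + δ) ^ q := fun x q => by
    rw [← Real.rpow_natCast, ← Real.rpow_mul (hFpos x).le]
    congr 1
    push_cast
    ring
  have hsob := hS.sq_le hn hc hCs hw hu
  simp only [mul_pow, hrp] at hsob
  obtain ⟨K, hK⟩ := hf
  have hls : MeasurableSet (s ∩ {x | l < f x}) :=
    hs.inter (isOpen_lt continuous_const hK.continuous).measurableSet
  have hN := integral_mul_le_of_level (μ := riemVolume n M) (ν := n) (by linarith) hl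
    (hc' ⟨K, hK⟩) hwb hf0 hw0 hls
    (fun x hx => by rw [hηs x hx]; simp)
  refine absorb hc (abs_nonneg θ₂) (abs_nonneg θ₃) (by linarith) hl
    (Real.rpow_nonneg (integral_nonneg fun x => Real.rpow_nonneg (hw0 x) _) _) ?_
    (setIntegral_nonneg hs fun x _ => Real.rpow_nonneg (hFpos x).le _) hsob ?_
    (caccioppoli hθ hp hδ ⟨K, hK⟩ hf0 hW hη hη0 hs hηs) hN hy
  · rw [← integral_indicator hs]
    refine integral_mono hwb.integrable (hFp.indicator hs).integrable fun x => ?_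
    by_cases hx : x ∈ s
    · simp only [indicator_of_mem hx]
      exact mul_le_of_le_one_left (Real.rpow_nonneg (hFpos x).le _)
        (pow_le_one₀ (hη0 x) (hη1 x))
    · simp [indicator_of_notMem hx, hηs x hx]
  · rw [← integral_indicator hs, ← integral_const_mul, ← integral_const_mul,
      ← integral_add ((BddAEMeas.const _).mul ((((hc' hη').pow 2).mul hEb).mul hA)).integrable
        ((BddAEMeas.const _).mul (hFp.indicator hs)).integrable]
    refine integral_mono_ae ((BddAEMeas.norm_grad hu).pow 2).integrable
      (((BddAEMeas.const _).mul ((((hc' hη').pow 2).mul hEb).mul hA)).add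
        ((BddAEMeas.const _).mul (hFp.indicator hs))).integrable ?_
    filter_upwards [ae_mdifferentiableAt hK, ae_mdifferentiableAt hη] with x hx hx'
    have h2 := grad_comp hx ((((hasDerivAt_id (f x)).add_const δ).rpow_const (p := p / 2)
      (Or.inl (hFpos x).ne')))
    have h3 := grad_mul hx' h2.1
    simp only [id] at h2 h3
    rw [h3.2, h2.2]
    have hC : ‖grad n η x‖ ^ 2 * (f x + δ) ^ p ≤
          G ^ 2 * s.indicator (fun x => (f x + δ) ^ p) x := by
      by_cases hx : x ∈ s
      · rw [indicator_of_mem hx]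
        have := norm_grad_le (n := n) hη x
        have h0 := Real.rpow_nonneg (hFpos x).le p
        gcongr
      · rw [indicator_of_notMem hx,
            grad_eq_zero_of_isMinOn fun z => by rw [hηs x hx]; exact hη0 z]
        simp
    have e1 : ((f x + δ) ^ (p / 2 - 1)) ^ 2 = (f x + δ) ^ (p - 2) := by
      rw [← hrp x (p - 2)]
      congr 2
      ring
    set a := η x • (1 * (p / 2) * (f x + δ) ^ (p / 2 - 1)) • grad n f x
    set b := (f x + δ) ^ (p / 2) • grad n η x
    have ha : ‖a‖ ^ 2 = p ^ 2 / 4 * (η x ^ 2 * (f x + δ) ^ (p - 2) * ‖grad n f x‖ ^ 2) := by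
      simp only [a, norm_smul, mul_pow, Real.norm_eq_abs, sq_abs, e1]
      ring
    have hb : ‖b‖ ^ 2 = ‖grad n η x‖ ^ 2 * (f x + δ) ^ p := by
      simp only [b, norm_smul, mul_pow, Real.norm_eq_abs, sq_abs, hrp]
      ring
    -- The gradient of `η (f + δ)^(p/2)` is `a + b`; the factor `p²/4` in `‖a‖²` is the source of
    -- the `p²` in the step constant.
    have hab : ‖a + b‖ ^ 2 ≤ 2 * ‖a‖ ^ 2 + 2 * ‖b‖ ^ 2 := by
      have := pow_le_pow_left₀ (norm_nonneg _) (norm_add_le a b) 2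
      nlinarith [sq_nonneg (‖a‖ - ‖b‖)]
    rw [ha, hb] at hab
    linarith

/-- The gain of integrability of a subsolution on a smaller ball. -/
lemma reverse_holder [IsFiniteMeasure (riemVolume n M)] (hn : 3 ≤ n) {f : M → ℝ}
    {σ Cs c w θ₁ θ₂ θ₃ p l R R' : ℝ} (hc : 0 < c) (hCs : c ≤ Cs)
    (hw : totalVolume n M ^ (-σ) ≤ w) (hS : SobolevInequality n M σ Cs)
    (hθ : θ₁ ≤ 1 / 4) (hp : 3 / 2 ≤ p) (hl : 0 ≤ l) (hf : ∃ K : ℝ≥0, LipschitzWith K f)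
    (hf0 : ∀ x, 0 ≤ f x) (hW : WeakDiffIneq n θ₁ θ₂ θ₃ f) (P : M) (hR : R' < R)
    (hy : 16 * |θ₃| / c ^ 2 * p ^ 2 *
      (∫ x in Metric.ball P R ∩ {x | l < f x}, f x ^ ((n : ℝ) / 2) ∂(riemVolume n M)) ^
        (2 / (n : ℝ)) ≤ 1) :
    (∫ x in Metric.ball P R', f x ^ (p * ((n : ℝ) / ((n : ℝ) - 2))) ∂(riemVolume n M)) ^
        (((n : ℝ) - 2) / (n : ℝ)) ≤
      stepConst c θ₂ θ₃ w * p ^ 2 * ((1 / (R - R')) ^ 2 + 1 + l) *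
        ∫ x in Metric.ball P R, f x ^ p ∂(riemVolume n M) := by
  have hn' : (3 : ℝ) ≤ n := by exact_mod_cast hn
  have hκ : 0 ≤ (n : ℝ) / ((n : ℝ) - 2) := div_nonneg (by linarith) (by linarith)
  obtain ⟨η, hη, hη0, hη1, hηone, hηzero⟩ := exists_cutoff P hR
  obtain ⟨K, hK⟩ := hf
  have hfc := hK.continuous
  have hRpos : 0 < R - R' := sub_pos.2 hR
  have hcont : ∀ δ : ℝ, ∀ q : ℝ, 0 ≤ q → Continuous fun x => (f x + δ) ^ q := fun δ q hq =>
    (hfc.add continuous_const).rpow_const fun x => Or.inr hq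
  have key : ∀ δ : ℝ, 0 < δ →
      (∫ x in Metric.ball P R', f x ^ (p * ((n : ℝ) / ((n : ℝ) - 2))) ∂(riemVolume n M)) ^
        (((n : ℝ) - 2) / (n : ℝ)) ≤
      stepConst c θ₂ θ₃ w * p ^ 2 * ((1 / (R - R')) ^ 2 + 1 + l) *
        ∫ x in Metric.ball P R, (f x + δ) ^ p ∂(riemVolume n M) := by
    intro δ hδ
    have h := weighted_reverse_holder hn hc hCs hw hS hθ hp hδ hl ⟨K, hK⟩ hf0 hW hη hη0 hη1
      Metric.isOpen_ball.measurableSet hηzero hy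
    rw [Real.coe_toNNReal _ (by positivity)] at h
    refine le_trans ?_ h
    refine Real.rpow_le_rpow (setIntegral_nonneg Metric.isOpen_ball.measurableSet
      fun x _ => Real.rpow_nonneg (hf0 x) _) ?_ (div_nonneg (by linarith) (by linarith))
    rw [← integral_indicator Metric.isOpen_ball.measurableSet]
    have hfb : BddAEMeas (riemVolume n M) f := BddAEMeas.of_continuous hfc
    refine integral_mono ((hfb.rpow (by positivity)).indicator
      Metric.isOpen_ball.measurableSet).integrable
        ((((BddAEMeas.of_continuous hη.continuous).pow 2).mul
        (BddAEMeas.of_continuous (hcont δ p (by linarith)))).rpow hκ).integrable fun x => ?_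
    have hfx := hf0 x
    by_cases hx : x ∈ Metric.ball P R'
    · simp only [indicator_of_mem hx]
      rw [hηone x hx, one_pow, one_mul, Real.rpow_mul hfx]
      gcongr
      linarith
    · simp only [indicator_of_notMem hx]
      positivity
  -- The constant does not involve `δ`, so `δ = 1/(k+1) → 0` by dominated convergence, with
  -- dominating function `(f + 1)^p`.
  have hlim : Filter.Tendsto (fun k : ℕ => stepConst c θ₂ θ₃ w * p ^ 2 *
      ((1 / (R - R')) ^ 2 + 1 + l) *
        ∫ x in Metric.ball P R, (f x + 1 / ((k : ℝ) + 1)) ^ p ∂(riemVolume n M)) Filter.atTop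
      (nhds (stepConst c θ₂ θ₃ w * p ^ 2 * ((1 / (R - R')) ^ 2 + 1 + l) *
        ∫ x in Metric.ball P R, f x ^ p ∂(riemVolume n M))) := by
    refine Filter.Tendsto.const_mul _ ?_
    refine tendsto_integral_of_dominated_convergence (fun x => (f x + 1) ^ p)
      (fun k => (hcont _ p (by linarith)).aestronglyMeasurable)
      (BddAEMeas.of_continuous (hcont _ p (by linarith))).integrable (fun k => ?_) ?_
    · refine Filter.Eventually.of_forall fun x => ?_
      have hfx := hf0 x
      rw [Real.norm_of_nonneg (by positivity)]
      gcongr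
      rw [div_le_one (by positivity)]
      linarith [(Nat.cast_nonneg k : (0 : ℝ) ≤ k)]
    · refine Filter.Eventually.of_forall fun x => ?_
      have h1 : Filter.Tendsto (fun k : ℕ => f x + 1 / ((k : ℝ) + 1)) Filter.atTop
          (nhds (f x + 0)) :=
        tendsto_const_nhds.add tendsto_one_div_add_atTop_nhds_zero_nat
      rw [add_zero] at h1
      exact h1.rpow_const (Or.inr (by linarith))
  exact ge_of_tendsto' hlim fun k => key _ (by positivity)

end ReverseHolder

/-! ### Iteration, passage to the supremum, Chebyshev -/

section Iteration

/-- Iterating `I (k + 1) ^ (1 / κ) ≤ D * b ^ k * I k`. -/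
lemma iterate_le {κ D b : ℝ} (hκ : 1 < κ) (hD : 1 ≤ D) (hb : 1 ≤ b) {I : ℕ → ℝ}
    (hI : ∀ k, 0 ≤ I k) (hstep : ∀ k, I (k + 1) ^ (1 / κ) ≤ D * b ^ k * I k) (k : ℕ) :
    I k ^ ((1 / κ) ^ k) ≤
      D ^ (1 / (1 - 1 / κ)) * b ^ (∑' j : ℕ, (j : ℝ) * (1 / κ) ^ j) * I 0 := by
  have hρ0 : 0 ≤ 1 / κ := by positivity
  have hρ1 : 1 / κ < 1 := (div_lt_one (by linarith)).2 hκ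
  have hD0 : 0 < D := by linarith
  have hb0 : 0 < b := by linarith
  have hs1 : Summable fun j : ℕ => (1 / κ) ^ j := summable_geometric_of_lt_one hρ0 hρ1
  have hs2 : Summable fun j : ℕ => (j : ℝ) * (1 / κ) ^ j := by
    simpa using summable_pow_mul_geometric_of_norm_lt_one 1
      (r := 1 / κ) (by rwa [Real.norm_of_nonneg hρ0])
  have key : ∀ k, I k ^ ((1 / κ) ^ k) ≤ D ^ (∑ j ∈ Finset.range k, (1 / κ) ^ j) *
      b ^ (∑ j ∈ Finset.range k, (j : ℝ) * (1 / κ) ^ j) * I 0 := by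
    intro k
    induction k with
    | zero => simp
    | succ k ih =>
      have hIk := hI k
      have h1 : I (k + 1) ^ ((1 / κ) ^ (k + 1)) = (I (k + 1) ^ (1 / κ)) ^ ((1 / κ) ^ k) := by
        rw [← Real.rpow_mul (hI _), pow_succ']
      rw [h1, Finset.sum_range_succ, Finset.sum_range_succ, Real.rpow_add hD0, Real.rpow_add hb0]
      calc (I (k + 1) ^ (1 / κ)) ^ ((1 / κ) ^ k) ≤ (D * b ^ k * I k) ^ ((1 / κ) ^ k) :=
            Real.rpow_le_rpow (Real.rpow_nonneg (hI _) _) (hstep k) (by positivity)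
        _ = D ^ ((1 / κ) ^ k) * b ^ ((k : ℝ) * (1 / κ) ^ k) * I k ^ ((1 / κ) ^ k) := by
            rw [Real.mul_rpow (by positivity) hIk, Real.mul_rpow hD0.le (by positivity),
              ← Real.rpow_natCast b k, ← Real.rpow_mul hb0.le]
        _ ≤ D ^ ((1 / κ) ^ k) * b ^ ((k : ℝ) * (1 / κ) ^ k) *
            (D ^ (∑ j ∈ Finset.range k, (1 / κ) ^ j) *
              b ^ (∑ j ∈ Finset.range k, (j : ℝ) * (1 / κ) ^ j) * I 0) := by gcongr
        _ = _ := by ring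
  refine (key k).trans ?_
  have hI0 := hI 0
  gcongr
  · have h := hs1.sum_le_tsum (Finset.range k) fun j _ => by positivity
    rwa [tsum_geometric_of_lt_one hρ0 hρ1, ← one_div] at h
  · exact hs2.sum_le_tsum (Finset.range k) fun j _ => by positivity

variable {X : Type*} [MetricSpace X] [CompactSpace X] [MeasurableSpace X] [BorelSpace X]
  {μ : Measure X} [IsFiniteMeasure μ]

/-- Bounds for the `L^p` norms on balls that contain `U`, with `p → ∞`, bound `f` on `U`. -/
lemma le_of_integral_rpow_le (hμ : ∀ U : Set X, IsOpen U → U.Nonempty → 0 < μ U) {f : X → ℝ}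
    (hf : Continuous f) (hf0 : ∀ x, 0 ≤ f x) {U : Set X} (hU : IsOpen U) {B : ℕ → Set X}
    (hUB : ∀ k, U ⊆ B k) {p : ℕ → ℝ} (hp : ∀ k, 0 < p k)
    (hptop : Filter.Tendsto p Filter.atTop Filter.atTop) {A : ℝ}
    (h : ∀ k, (∫ x in B k, f x ^ p k ∂μ) ^ (1 / p k) ≤ A) {x : X} (hx : x ∈ U) : f x ≤ A := by
  refine le_of_forall_lt fun L hL => ?_
  rcases lt_or_ge L 0 with hL0 | hL0
  · exact hL0.trans_le ((Real.rpow_nonneg (integral_nonneg fun x =>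
      Real.rpow_nonneg (hf0 x) _) _).trans (h 0))
  obtain ⟨L', hLL', hL'⟩ := exists_between hL
  refine hLL'.trans_le ?_
  have hL'0 : 0 ≤ L' := hL0.trans hLL'.le
  -- This set is open and contains `x`, so it has positive measure, and `L' μ(V)^(1/p_k) ≤ A` tends
  -- to `L' ≤ A`.
  set V := U ∩ {z | L' < f z} with hV
  have hVo : IsOpen V := hU.inter (isOpen_lt continuous_const hf)
  have hVpos : 0 < μ.real V := ENNReal.toReal_pos (hμ V hVo ⟨x, hx, hL'⟩).ne' (measure_ne_top _ _)
  have hk : ∀ k, L' * μ.real V ^ (1 / p k) ≤ A := by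
    intro k
    refine le_trans ?_ (h k)
    have hfp : BddAEMeas μ (fun x => f x ^ p k) :=
      (BddAEMeas.of_continuous hf).rpow (hp k).le
    have h1 : L' ^ p k * μ.real V ≤ ∫ x in B k, f x ^ p k ∂μ := by
      calc L' ^ p k * μ.real V = ∫ x in V, L' ^ p k ∂μ := by
            rw [setIntegral_const, smul_eq_mul, mul_comm]
        _ ≤ ∫ x in V, f x ^ p k ∂μ := by
            refine setIntegral_mono_on (integrable_const _).integrableOn hfp.integrable.integrableOn
              hVo.measurableSet fun z hz => ?_
            exact Real.rpow_le_rpow hL'0 (le_of_lt hz.2) (hp k).le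
        _ ≤ ∫ x in B k, f x ^ p k ∂μ := by
            refine setIntegral_mono_set hfp.integrable.integrableOn
              (Filter.Eventually.of_forall fun z => Real.rpow_nonneg (hf0 z) _) ?_
            exact Filter.Eventually.of_forall fun z hz => hUB k hz.1
    calc L' * μ.real V ^ (1 / p k) = (L' ^ p k * μ.real V) ^ (1 / p k) := by
          rw [Real.mul_rpow (Real.rpow_nonneg hL'0 _) hVpos.le, ← Real.rpow_mul hL'0,
            mul_one_div_cancel (hp k).ne', Real.rpow_one]
      _ ≤ _ := Real.rpow_le_rpow (mul_nonneg (Real.rpow_nonneg hL'0 _) hVpos.le) h1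
          (one_div_nonneg.2 (hp k).le)
  have hlim : Filter.Tendsto (fun k => L' * μ.real V ^ (1 / p k)) Filter.atTop (nhds (L' * 1)) := by
    refine Filter.Tendsto.const_mul _ ?_
    have h1 : Filter.Tendsto (fun k => 1 / p k) Filter.atTop (nhds 0) := by
      simp only [one_div]
      exact hptop.inv_tendsto_atTop
    have h2 := (Real.continuousAt_const_rpow (a := μ.real V) (b := 0) hVpos.ne').tendsto.comp h1
    rwa [Real.rpow_zero] at h2
  rw [mul_one] at hlim
  exact le_of_tendsto' hlim hk

/-- On `{f > l}` one has `f^(α-β) ≤ l^(α-β)`, as the exponent is nonpositive. Higher integrability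
thus makes the lower power small above a high level. -/
lemma chebyshev_rpow {f : X → ℝ} (hf : Continuous f) (hf0 : ∀ x, 0 ≤ f x) {s : Set X}
    (hs : MeasurableSet s) {l α β : ℝ} (hl : 0 < l) (hα : 0 < α) (hαβ : α ≤ β) :
    ∫ x in s ∩ {x | l < f x}, f x ^ α ∂μ ≤ l ^ (α - β) * ∫ x in s, f x ^ β ∂μ := by
  have hfα : BddAEMeas μ (fun x => f x ^ α) := (BddAEMeas.of_continuous hf).rpow hα.le
  have hfβ : BddAEMeas μ (fun x => f x ^ β) :=
    (BddAEMeas.of_continuous hf).rpow (hα.le.trans hαβ)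
  have hls : MeasurableSet (s ∩ {x | l < f x}) :=
    hs.inter (isOpen_lt continuous_const hf).measurableSet
  rw [← integral_const_mul]
  calc _ ≤ ∫ x in s ∩ {x | l < f x}, l ^ (α - β) * f x ^ β ∂μ := by
        refine setIntegral_mono_on hfα.integrable.integrableOn
          ((BddAEMeas.const _).mul hfβ).integrable.integrableOn hls fun x hx => ?_
        have hfx : 0 < f x := hl.trans hx.2
        calc f x ^ α = f x ^ (α - β) * f x ^ β := by rw [← Real.rpow_add hfx]; ring_nf
          _ ≤ l ^ (α - β) * f x ^ β := by
            refine mul_le_mul_of_nonneg_right ?_ (Real.rpow_nonneg hfx.le _)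
            exact Real.rpow_le_rpow_of_nonpos hl (le_of_lt hx.2) (by linarith)
    _ ≤ _ := by
        refine setIntegral_mono_set ((BddAEMeas.const _).mul hfβ).integrable.integrableOn
          (Filter.Eventually.of_forall fun z => mul_nonneg (Real.rpow_nonneg hl.le _)
            (Real.rpow_nonneg (hf0 z) _)) ?_
        exact Filter.Eventually.of_forall fun z hz => hz.1

end Iteration

/-! ### The Moser iteration -/

section MainEstimate

/-- The growth of the constants along the iteration. -/
lemma step_growth {K q ε m κ ν r : ℝ} (hK : 0 < K) (hq : 0 < q) (hε : 0 < ε) (hm : 0 < m)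
    (hκ : 1 < κ) (hν : 2 ≤ ν) (hr : 0 < r) (k : ℕ) :
    K * (q * (κ ^ 2) ^ k) * (16 * 4 ^ k / r ^ 2 + 1 +
        16 * K * q * ε * (1 + 1 / r ^ 2) * (m * (κ ^ 2) ^ k) ^ ((ν - 2) / 2)) ≤
      (1 + K * q * (16 + 16 * K * q * ε * m ^ ((ν - 2) / 2))) * (1 + 1 / r ^ 2) *
        (κ ^ 2 * (4 * κ ^ (ν - 2))) ^ k := by
  have hκ0 : 0 < κ := by linarith
  set X := 1 + 1 / r ^ 2 with hX
  have hX1 : 1 / r ^ 2 = X - 1 := by rw [hX]; ring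
  have hXp : 0 ≤ 1 / r ^ 2 := by positivity
  have hX0 : 1 ≤ X := by linarith
  set z := κ ^ (ν - 2) with hz
  have hz1 : 1 ≤ z := Real.one_le_rpow hκ.le (by linarith)
  have hpow : (m * (κ ^ 2) ^ k) ^ ((ν - 2) / 2) = m ^ ((ν - 2) / 2) * z ^ k := by
    rw [Real.mul_rpow hm.le (by positivity), hz, ← Real.rpow_natCast (κ ^ (ν - 2)) k,
      ← Real.rpow_mul hκ0.le, ← pow_mul, ← Real.rpow_natCast κ (2 * k), ← Real.rpow_mul hκ0.le]
    congr 2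
    push_cast
    ring
  rw [hpow]
  set y := m ^ ((ν - 2) / 2)
  have hy : 0 < y := Real.rpow_pos_of_pos hm _
  have h4 : (1 : ℝ) ≤ 4 ^ k := one_le_pow₀ (by norm_num)
  have hzk : 1 ≤ z ^ k := one_le_pow₀ hz1
  have e1 : 16 * 4 ^ k / r ^ 2 + 1 ≤ 16 * X * (4 ^ k * z ^ k) := by
    calc 16 * 4 ^ k / r ^ 2 + 1 = 16 * 4 ^ k * (X - 1) + 1 := by rw [← hX1]; ring
      _ ≤ 16 * X * 4 ^ k := by nlinarith
      _ ≤ 16 * X * (4 ^ k * z ^ k) := by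
          gcongr
          exact le_mul_of_one_le_right (by positivity) hzk
  have e2 : 16 * K * q * ε * X * (y * z ^ k) ≤ 16 * K * q * ε * X * (y * (4 ^ k * z ^ k)) := by
    gcongr
    exact le_mul_of_one_le_left (by positivity) h4
  calc K * (q * (κ ^ 2) ^ k) * (16 * 4 ^ k / r ^ 2 + 1 + 16 * K * q * ε * X * (y * z ^ k))
      ≤ K * (q * (κ ^ 2) ^ k) * (16 * X * (4 ^ k * z ^ k) +
          16 * K * q * ε * X * (y * (4 ^ k * z ^ k))) := by gcongr
    _ = K * q * (16 + 16 * K * q * ε * y) * X * (κ ^ 2 * (4 * z)) ^ k := by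
        rw [mul_pow (κ ^ 2), mul_pow 4 z]; ring
    _ ≤ _ := by
        gcongr
        linarith

variable {n : ℕ} {M : Type*} [MetricSpace M] [CompactSpace M]
  [ChartedSpace (EuclideanSpace ℝ (Fin n)) M] [IsManifold (𝓡 n) ∞ M]
  [Bundle.RiemannianBundle (fun x : M => TangentSpace (𝓡 n) x)]
  [IsContinuousRiemannianBundle (EuclideanSpace ℝ (Fin n)) (fun x : M => TangentSpace (𝓡 n) x)]
  [IsRiemannianManifold (𝓡 n) M] [MeasurableSpace M] [BorelSpace M]

lemma moser_estimate [IsFiniteMeasure (riemVolume n M)] (hn : 3 ≤ n) {f : M → ℝ}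
    {σ Cs c w θ₁ θ₂ θ₃ r κ m ε K : ℝ} (hc : 0 < c) (hCs : c ≤ Cs)
    (hw : totalVolume n M ^ (-σ) ≤ w) (hS : SobolevInequality n M σ Cs)
    (hθ : θ₁ ≤ 1 / 4) (hf : ∃ K : ℝ≥0, LipschitzWith K f)
    (hf0 : ∀ x, 0 ≤ f x) (hW : WeakDiffIneq n θ₁ θ₂ θ₃ f) (P : M) (hr : 0 < r)
    (hκ : κ = (n : ℝ) / ((n : ℝ) - 2))
    (hm : m = (16 * |θ₃| / c ^ 2 + 1) * ((n : ℝ) / 2) ^ 2) (hε : ε = m ^ (-((n : ℝ) / 2)))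
    (hK : K = stepConst c θ₂ θ₃ w)
    (hsmall : ∫ x in Metric.ball P r, f x ^ ((n : ℝ) / 2) ∂(riemVolume n M) ≤ ε)
    {x : M} (hx : x ∈ Metric.ball P (r / 2)) :
    f x ≤ (1 + K * ((n : ℝ) / 2) ^ 2 * (16 + 16 * K * ((n : ℝ) / 2) ^ 2 * ε *
        m ^ (((n : ℝ) - 2) / 2))) * (1 + 1 / r ^ 2) *
        (κ ^ 2 * (4 * κ ^ ((n : ℝ) - 2))) ^ (2 / (n : ℝ) * ∑' j : ℕ, (j : ℝ) * (1 / κ) ^ j) *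
      (∫ z in Metric.ball P r, f z ^ ((n : ℝ) / 2) ∂(riemVolume n M)) ^ (2 / (n : ℝ)) := by
  have hν : (3 : ℝ) ≤ n := by exact_mod_cast hn
  set ν : ℝ := (n : ℝ) with hνdef
  have hν2 : 0 < ν - 2 := by linarith
  have hν0 : 0 < ν := by linarith
  have hκ1 : 1 < κ := by
    rw [hκ, one_lt_div hν2]
    linarith
  have hκ0 : 0 < κ := by linarith
  have hκinv : (ν - 2) / ν = 1 / κ := by rw [hκ, one_div_div]
  set q := (ν / 2) ^ 2 with hq
  have hq0 : 0 < q := by positivity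
  set a₀ := 16 * |θ₃| / c ^ 2 with ha₀
  have ha0 : 0 ≤ a₀ := by positivity
  have hm0 : 0 < m := by rw [hm]; positivity
  have hε0 : 0 < ε := by rw [hε]; positivity
  have hK0 : 0 < K := by rw [hK]; exact stepConst_pos hc _ _ _
  set X := 1 + 1 / r ^ 2 with hX
  have hX1 : 1 ≤ X := by rw [hX]; linarith [show (0 : ℝ) ≤ 1 / r ^ 2 by positivity]
  set H := 16 * K * q * ε * X with hH
  have hH0 : 0 < H := by positivity
  -- The radii decrease from `r` to `r/2`; the exponents start at `n/2 ≥ 3/2`, the least value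
  -- allowed in the Caccioppoli estimate.
  set R : ℕ → ℝ := fun k => r / 2 * (1 + (1 / 2) ^ k) with hR
  set p : ℕ → ℝ := fun k => ν / 2 * κ ^ k with hp
  set I : ℕ → ℝ := fun k => ∫ x in Metric.ball P (R k), f x ^ p k ∂(riemVolume n M) with hI
  have hR0 : R 0 = r := by simp only [hR, pow_zero]; ring
  have hp0 : p 0 = ν / 2 := by simp [hp]
  have hI0 : I 0 = ∫ x in Metric.ball P r, f x ^ (ν / 2) ∂(riemVolume n M) := by
    simp only [hI, hR0, hp0]
  have hRdiff : ∀ k, R k - R (k + 1) = r / (4 * 2 ^ k) := fun k => by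
    simp only [hR, pow_succ, one_div, inv_pow]
    field_simp
    ring
  have hRlt : ∀ k, R (k + 1) < R k := fun k => by
    rw [← sub_pos, hRdiff]
    positivity
  have hRinv : ∀ k, (1 / (R k - R (k + 1))) ^ 2 = 16 * 4 ^ k / r ^ 2 := fun k => by
    rw [hRdiff, one_div_div, div_pow, mul_pow, ← pow_mul, mul_comm k 2, pow_mul]
    norm_num
  have hp1 : ∀ k, 3 / 2 ≤ p k := fun k => by
    have : 1 ≤ κ ^ k := one_le_pow₀ hκ1.le
    simp only [hp]
    nlinarith
  have hpsq : ∀ k, p k ^ 2 = q * (κ ^ 2) ^ k := fun k => by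
    simp only [hp, hq]
    ring
  have hInn : ∀ k, 0 ≤ I k := fun k => integral_nonneg fun x => Real.rpow_nonneg (hf0 x) _
  have hstep : ∀ k, ∀ l, 0 ≤ l → a₀ * p k ^ 2 * (∫ x in Metric.ball P (R k) ∩ {x | l < f x},
      f x ^ (ν / 2) ∂(riemVolume n M)) ^ (2 / ν) ≤ 1 →
      I (k + 1) ^ (1 / κ) ≤ K * p k ^ 2 * (16 * 4 ^ k / r ^ 2 + 1 + l) * I k := by
    intro k l hl h
    have := reverse_holder hn hc hCs hw hS hθ (hp1 k) hl hf hf0 hW P (hRlt k) h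
    rw [hRinv, ← hνdef, hκinv, ← hκ, ← hK] at this
    have hpk : p k * κ = p (k + 1) := by simp only [hp, pow_succ, mul_assoc]
    rw [hpk] at this
    exact this
  obtain ⟨L, hL⟩ := hf
  have hfc := hL.continuous
  have hI0ε : I 0 ≤ ε := by rw [hI0]; exact hsmall
  -- Level `l = 0` is admissible here because `ε^(2/n) = 1/m` and `m ≥ a₀ p_0²`. This is where the
  -- smallness hypothesis gives the absorption.
  have hfirst : I 1 ^ (1 / κ) ≤ K * p 0 ^ 2 * (16 * 4 ^ 0 / r ^ 2 + 1 + 0) * I 0 := by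
    refine hstep 0 0 le_rfl ?_
    have h1 : ∫ x in Metric.ball P (R 0) ∩ {x | 0 < f x}, f x ^ (ν / 2) ∂(riemVolume n M) ≤ ε := by
      refine le_trans ?_ hI0ε
      rw [hI0, hR0]
      exact setIntegral_mono_set (((BddAEMeas.of_continuous hfc).rpow
        (by positivity)).integrable.integrableOn)
        (Filter.Eventually.of_forall fun z => Real.rpow_nonneg (hf0 z) _)
        (Filter.Eventually.of_forall fun z hz => hz.1)
    have h2 := Real.rpow_le_rpow (integral_nonneg fun x => Real.rpow_nonneg (hf0 x) _) h1
      (show 0 ≤ 2 / ν by positivity)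
    have h3 : ε ^ (2 / ν) = m⁻¹ := by
      rw [hε, ← Real.rpow_mul hm0.le, ← Real.rpow_neg_one]
      congr 1
      field_simp
    rw [h3] at h2
    rw [hp0, ← hq]
    calc _ ≤ a₀ * q * m⁻¹ := by gcongr
      _ ≤ 1 := by
        rw [← div_eq_mul_inv, div_le_one hm0, hm]
        gcongr
        linarith
  have hfirstH : I 1 ^ (1 / κ) ≤ H := by
    refine hfirst.trans ?_
    rw [hp0, ← hq, pow_zero, mul_one, add_zero]
    have : 16 / r ^ 2 + 1 ≤ 16 * X := by
      rw [hX]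
      have : 16 / r ^ 2 = 16 * (1 / r ^ 2) := by ring
      linarith
    have hI00 := hInn 0
    calc _ ≤ K * q * (16 * X) * ε := by gcongr
      _ = H := by rw [hH]; ring
  have hI1 : I 1 ≤ H ^ κ := by
    have := Real.rpow_le_rpow (Real.rpow_nonneg (hInn 1) _) hfirstH hκ0.le
    rwa [← Real.rpow_mul (hInn 1), one_div_mul_cancel hκ0.ne', Real.rpow_one] at this
  set D := (1 + K * q * (16 + 16 * K * q * ε * m ^ ((ν - 2) / 2))) * X with hD
  set b := κ ^ 2 * (4 * κ ^ (ν - 2)) with hb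
  have hsteps : ∀ k, I (k + 1) ^ (1 / κ) ≤ D * b ^ k * I k := by
    intro k
    have hgrow := step_growth hK0 hq0 hε0 hm0 hκ1 (show 2 ≤ ν by linarith) hr k
    rw [← hX, ← hH, ← hD, ← hb, ← hpsq] at hgrow
    have hll : 0 ≤ H * (m * (κ ^ 2) ^ k) ^ ((ν - 2) / 2) := by positivity
    have hIk := hInn k
    rcases Nat.eq_zero_or_pos k with rfl | hk
    · refine hfirst.trans (le_trans ?_ (mul_le_mul_of_nonneg_right hgrow hIk))
      gcongr
    refine (hstep k _ hll ?_).trans (mul_le_mul_of_nonneg_right hgrow hIk)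
    -- The level is chosen so that `((H/l)^κ)^(2/n) = 1/(m κ^(2k))`, which compensates the growth of
    -- `p_k² = (n/2)² κ^(2k)`.
    set l := H * (m * (κ ^ 2) ^ k) ^ ((ν - 2) / 2) with hldef
    have hl0 : 0 < l := by positivity
    have hcheb := chebyshev_rpow (μ := riemVolume n M) hfc hf0
      (s := Metric.ball P (R k)) Metric.isOpen_ball.measurableSet hl0 (α := ν / 2) (β := ν / 2 * κ)
      (by positivity) (le_mul_of_one_le_right (by positivity) hκ1.le)
    -- The bound `H ^ κ` is available only on the ball of radius `R 1`, so the step `k = 0` was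
    -- treated separately.
    have hRk : R k ≤ R 1 := by
      have : ((1 : ℝ) / 2) ^ k ≤ (1 / 2) ^ 1 := pow_le_pow_of_le_one (by norm_num) (by norm_num) hk
      simp only [hR]
      gcongr
    have hball : ∫ x in Metric.ball P (R k), f x ^ (ν / 2 * κ) ∂(riemVolume n M) ≤ H ^ κ := by
      refine le_trans ?_ hI1
      simp only [hI, hp, pow_one]
      exact setIntegral_mono_set (((BddAEMeas.of_continuous hfc).rpow
        (by positivity)).integrable.integrableOn)
        (Filter.Eventually.of_forall fun z => Real.rpow_nonneg (hf0 z) _)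
        (Filter.Eventually.of_forall fun z hz => Metric.ball_subset_ball hRk hz)
    have hexp : ν / 2 - ν / 2 * κ = -κ := by
      rw [hκ]
      field_simp
      ring
    rw [hexp] at hcheb
    have h1 : ∫ x in Metric.ball P (R k) ∩ {x | l < f x}, f x ^ (ν / 2) ∂(riemVolume n M) ≤
        (H / l) ^ κ := by
      refine hcheb.trans ?_
      rw [Real.div_rpow hH0.le hl0.le, Real.rpow_neg hl0.le, div_eq_inv_mul (H ^ κ)]
      gcongr
    have h2 := Real.rpow_le_rpow (integral_nonneg fun x => Real.rpow_nonneg (hf0 x) _) h1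
      (show 0 ≤ 2 / ν by positivity)
    have hmk : 0 < m * (κ ^ 2) ^ k := by positivity
    have h3 : ((H / l) ^ κ) ^ (2 / ν) = (m * (κ ^ 2) ^ k)⁻¹ := by
      have : H / l = (m * (κ ^ 2) ^ k) ^ (-((ν - 2) / 2)) := by
        rw [hldef, Real.rpow_neg hmk.le]
        field_simp
      rw [this, ← Real.rpow_mul hmk.le, ← Real.rpow_mul hmk.le, ← Real.rpow_neg_one, hκ]
      congr 1
      field_simp
    rw [h3] at h2
    calc _ ≤ a₀ * p k ^ 2 * (m * (κ ^ 2) ^ k)⁻¹ := by gcongr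
      _ ≤ 1 := by
        rw [hpsq, ← div_eq_mul_inv, div_le_one hmk, hm, ← mul_assoc]
        gcongr
        linarith
  have hD1 : 1 ≤ D := by
    have h0 : 0 ≤ K * q * (16 + 16 * K * q * ε * m ^ ((ν - 2) / 2)) := by positivity
    rw [hD]
    exact one_le_mul_of_one_le_of_one_le (by linarith) hX1
  have hb1 : 1 ≤ b := by
    have h1 : 1 ≤ κ ^ (ν - 2) := Real.one_le_rpow hκ1.le hν2.le
    rw [hb]
    exact one_le_mul_of_one_le_of_one_le (one_le_pow₀ hκ1.le) (by linarith)
  have hfinal : ∀ k, I k ^ (1 / p k) ≤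
      D * b ^ (2 / ν * ∑' j : ℕ, (j : ℝ) * (1 / κ) ^ j) * I 0 ^ (2 / ν) := by
    intro k
    have h1 := iterate_le hκ1 hD1 hb1 hInn hsteps k
    have h2 := Real.rpow_le_rpow (Real.rpow_nonneg (hInn k) _) h1 (show 0 ≤ 2 / ν by positivity)
    have hD0 : 0 ≤ D := by linarith
    have hb0 : 0 ≤ b := by linarith
    rw [← Real.rpow_mul (hInn k), Real.mul_rpow (by positivity) (hInn 0),
      Real.mul_rpow (by positivity) (by positivity), ← Real.rpow_mul hD0, ← Real.rpow_mul hb0,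
      mul_comm (∑' j : ℕ, (j : ℝ) * (1 / κ) ^ j)] at h2
    -- As `1 - 1/κ = 2/n`, the constant `D`, and with it `1 + 1/r²`, enters to the first power.
    have e1 : 1 / (1 - 1 / κ) * (2 / ν) = 1 := by
      rw [← hκinv]
      field_simp
      ring
    have e2 : (1 / κ) ^ k * (2 / ν) = 1 / p k := by
      simp only [hp, div_pow, one_pow]
      field_simp
    rwa [e1, e2, Real.rpow_one] at h2
  rw [hI0] at hfinal
  refine le_of_integral_rpow_le (μ := riemVolume n M)
    (fun U hU hne => riemVolume_pos_of_isOpen hU hne)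
    hfc hf0 Metric.isOpen_ball (B := fun k => Metric.ball P (R k)) (fun k => ?_)
    (fun k => lt_of_lt_of_le (by norm_num) (hp1 k)) ?_ hfinal hx
  · refine Metric.ball_subset_ball ?_
    simp only [hR]
    exact le_mul_of_one_le_right (by positivity)
      (by linarith [show (0 : ℝ) ≤ (1 / 2) ^ k by positivity])
  · exact (tendsto_pow_atTop_atTop_of_one_lt hκ1).const_mul_atTop (by positivity)

end MainEstimate
end MoserLemma

/-! ### Choice of the constants and conclusion -/

theorem lemma3p1 (n : ℕ) (hn : 3 ≤ n) (θ₃ c : ℝ) (hc : 0 < c) :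
    ∃ ε : ℝ, 0 < ε ∧ ∀ σ : ℝ, 0 ≤ σ → ∀ θ₂ v : ℝ, 0 < v → ∃ C : ℝ, 0 < C ∧
      ∀ (M : Type*) [MetricSpace M] [CompactSpace M]
        [ChartedSpace (EuclideanSpace ℝ (Fin n)) M] [IsManifold (𝓡 n) ∞ M]
        [Bundle.RiemannianBundle (fun x : M => TangentSpace (𝓡 n) x)]
        [IsContMDiffRiemannianBundle (𝓡 n) ∞ (EuclideanSpace ℝ (Fin n))
          (fun x : M => TangentSpace (𝓡 n) x)]
        [IsRiemannianManifold (𝓡 n) M] [MeasurableSpace M] [BorelSpace M]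
        (Cs : ℝ), c ≤ Cs → v ≤ MoserLemma.totalVolume n M →
        MoserLemma.SobolevInequality n M σ Cs →
        ∀ (θ₁ : ℝ), θ₁ ≤ 1 / 4 →
        ∀ f : M → ℝ, (∃ K : ℝ≥0, LipschitzWith K f) → (∀ x, 0 ≤ f x) →
          MoserLemma.WeakDiffIneq n θ₁ θ₂ θ₃ f →
        ∀ (P : M) (r : ℝ), 0 < r →
          ∫ x in Metric.ball P (2 * r), f x ^ ((n : ℝ) / 2) ∂(MoserLemma.riemVolume n M) ≤ ε →
          ∀ x ∈ Metric.ball P (r / 2),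
            f x ≤ C * (1 + 1 / r ^ 2) *
              (∫ z in Metric.ball P r, f z ^ ((n : ℝ) / 2) ∂(MoserLemma.riemVolume n M)) ^
                (2 / (n : ℝ)) := by
  have hν : (3 : ℝ) ≤ n := by exact_mod_cast hn
  have hν2 : (0 : ℝ) < (n : ℝ) - 2 := by linarith
  have hn0 : (0 : ℝ) < n := by linarith
  -- The absorption coefficient at the initial exponent `n/2`; the summand `1` keeps it positive
  -- when `θ₃ = 0`.
  obtain ⟨m, hm⟩ : ∃ m : ℝ, m = (16 * |θ₃| / c ^ 2 + 1) * ((n : ℝ) / 2) ^ 2 := ⟨_, rfl⟩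
  obtain ⟨κ, hκ⟩ : ∃ κ : ℝ, κ = (n : ℝ) / ((n : ℝ) - 2) := ⟨_, rfl⟩
  obtain ⟨ε, hε⟩ : ∃ ε : ℝ, ε = m ^ (-((n : ℝ) / 2)) := ⟨_, rfl⟩
  have hm0 : 0 < m := by rw [hm]; positivity
  have hκ0 : 0 < κ := by rw [hκ]; positivity
  have hε0 : 0 < ε := by rw [hε]; positivity
  refine ⟨ε, hε0, fun σ hσ θ₂ v hv => ?_⟩
  obtain ⟨K, hK⟩ : ∃ K : ℝ, K = MoserLemma.stepConst c θ₂ θ₃ (v ^ (-σ)) := ⟨_, rfl⟩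
  have hK0 : 0 < K := by rw [hK]; exact MoserLemma.stepConst_pos hc _ _ _
  refine ⟨(1 + K * ((n : ℝ) / 2) ^ 2 * (16 + 16 * K * ((n : ℝ) / 2) ^ 2 * ε *
        m ^ (((n : ℝ) - 2) / 2))) *
        (κ ^ 2 * (4 * κ ^ ((n : ℝ) - 2))) ^ (2 / (n : ℝ) * ∑' j : ℕ, (j : ℝ) * (1 / κ) ^ j),
    by positivity, ?_⟩
  intro M _ _ _ _ _ _ _ _ _ Cs hCs hV hS θ₁ hθ f hf hf0 hW P r hr hsmall x hx
  have := MoserLemma.isContinuousRiemannianBundle_tangentSpace (n := n) (M := M)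
  -- An infinite volume would have real value `0`, contradicting `0 < v ≤ Vol(M)`.
  have : IsFiniteMeasure (MoserLemma.riemVolume n M) := by
    refine ⟨lt_top_iff_ne_top.2 fun htop => ?_⟩
    have : MoserLemma.totalVolume n M = 0 := by
      simp [MoserLemma.totalVolume, Measure.real, htop]
    linarith
  have hsmall' : ∫ x in Metric.ball P r, f x ^ ((n : ℝ) / 2) ∂(MoserLemma.riemVolume n M) ≤ ε := by
    refine le_trans ?_ hsmall
    obtain ⟨L, hL⟩ := hf
    exact setIntegral_mono_set (((MoserLemma.BddAEMeas.of_continuous hL.continuous).rpow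
      (by positivity)).integrable.integrableOn)
      (Filter.Eventually.of_forall fun z => Real.rpow_nonneg (hf0 z) _)
      (Filter.Eventually.of_forall fun z hz => Metric.ball_subset_ball (by linarith) hz)
  -- Since `σ ≥ 0`, the lower volume bound gives `Vol(M)^(-σ) ≤ v^(-σ)`, which makes the constant
  -- uniform in `M`.
  have h := MoserLemma.moser_estimate hn hc hCs
    (Real.rpow_le_rpow_of_nonpos hv hV (by linarith)) hS hθ hf hf0 hW P hr hκ hm hε hK hsmall' hx
  refine h.trans (le_of_eq ?_)
  ring
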